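/- Let $\mathcal F$ be a signature (a set of function symbols, each with a fixed arity), let $\mathcal V$ be a countably infinite set of variables, and let $\mathcal T(\mathcal F,\mathcal V)$ be the set of terms. Let $\square\notin\mathcal F\cup\mathcal V$ be a fresh constant, the hole. A context is a term over $\mathcal F\cup\{\square\}$ and $\mathcal V$ (with any number of holes, possibly none); $\mathcal C(\mathcal F,\mathcal V)$ is the set of contexts. Let $\sqsubseteq$ be the smallest reflexive and transitive relation on contexts that is monotone (closed under application of function symbols) and satisfies $\square\sqsubseteq C$ for all contexts $C$; $C\sqcup D$ denotes the supremum of $C$ and $D$ with respect to $\sqsubseteq$, which is defined only if it exists. $C|_p$ is the subterm of $C$ at position $p$ and $C[D]_p$ is the result of replacing it by $D$. $\mathcal{P}os_{\mathcal F}(C)$ and $\mathcal{P}os_{\square}(C)$ are the sets of positions of $C$ at which a symbol of $\mathcal F$, respectively a hole, occurs. A term rewrite system (TRS) $\mathcal R$ is a set of rules $\ell\to r$ with $\ell,r\in\mathcal T(\mathcal F,\mathcal V)$, where $\ell$ is not a variable and every variable of $r$ occurs in $\ell$. For terms or contexts $s,t$ we write $s\to_{p,\ell\to r}t$ if there is a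 substitution $\sigma$ with $s|_p=\ell\sigma$ and $t=s[r\sigma]_p$ (the hole is treated as a constant), and $\to_{\mathcal R}$ is the induced rewrite relation on $\mathcal T(\mathcal F,\mathcal V)$. A relation $\to$ is confluent if $b\mathrel{{}^*{\leftarrow}}a\to^*c$ always implies $b\to^*d\mathrel{{}^*{\leftarrow}}c$ for some $d$; it is confluent on a set $S$ if $S$ is closed under $\to$ and ${\to}\cap(S\times S)$ is confluent. $\mathcal R$ is confluent if $\to_{\mathcal R}$ is. Let $\mathbb L\subseteq\mathcal C(\mathcal F,\mathcal V)$. A top of a context $C$ is an $L\in\mathbb L$ with $L\sqsubseteq C$; a max-top of $C$ is a top of $C$ that is maximal with respect to $\sqsubseteq$ among the tops of $C$. $\mathbb L$ is a layer system if - (L1) each term in $\mathcal T(\mathcal F,\mathcal V)$ has a top different from $\square$; - (L2) if $x\in\mathcal V$, $C\in\mathcal C(\mathcal F,\mathcal V)$ and $p$ is a position of $C$, then $C[x]_p\in\mathbb L$ if and only if $C[\square]_p\in\mathbb L$; - (L3) if $L,N\in\mathbb L$, $p\in\mathcal{P}os_{\mathcal F}(L)$ and $L|_p\sqcup N$ is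 defined, then $L[L|_p\sqcup N]_p\in\mathbb L$. A TRS $\mathcal R$ is layered according to a layer system $\mathbb L$ if - (W) for every rule $\ell\to r$ of $\mathcal R$ and all terms $s,t$: if $M$ is a max-top of $s$, $p\in\mathcal{P}os_{\mathcal F}(M)$ and $s\to_{p,\ell\to r}t$, then $M\to_{p,\ell\to r}L$ for some $L\in\mathbb L$; - (C1) in (W), either $L$ is a max-top of $t$ or $L=\square$; - (C2) if $L,N\in\mathbb L$ and $L\sqsubseteq N$, then $L[N|_p]_p\in\mathbb L$ for every $p\in\mathcal{P}os_{\square}(L)$. In a layer system every term $t$ has a unique max-top $M$, and $M\neq\square$. Write $t=M[t_1,\dots,t_n]$, where $t_1,\dots,t_n$ are the subterms of $t$ at the positions of the holes of $M$. The rank of $t$ is defined recursively by $\operatorname{rank}(t)=1+\max\{\operatorname{rank}(t_i)\mid 1\le i\le n\}$, where $\max\varnothing=0$. **Theorem.** Let $\mathcal R$ be a TRS that is layered according to a layer system $\mathbb L$. If $\mathcal R$ is confluent on the set of terms of rank one, then $\mathcal R$ is confluent. (No linearity or non-duplication condition on $\mathcal R$ is assumed.) -/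

import Mathlib

universe u v w w'

namespace LayerSystem

/- A signature is a first-order language `F`, of which only the function symbols are used:
`F.Functions n` is the set of function symbols of arity `n`. Terms over `F` with variables from `V`
are Mathlib's terms `F.Term V`. -/

/-- Contexts with an arbitrary number of holes: terms over `F` with variables from `V` and one
additional atom, the hole. The atom `some x` stands for the variable `x`, the atom `none` for the
hole. -/
abbrev Ctx (F : FirstOrder.Language.{u, v}) (V : Type w) : Type (max u w) := F.Term (Option V)

/-- The hole, that is, the empty context. -/
def hole {F : FirstOrder.Language.{u, v}} {V : Type w} : Ctx F V := FirstOrder.Language.Term.var none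

/-- A variable, seen as a context. -/
def ctxVar {F : FirstOrder.Language.{u, v}} {V : Type w} (x : V) : Ctx F V := FirstOrder.Language.Term.var (some x)

/-- A term, seen as a context without holes. -/
def toCtx {F : FirstOrder.Language.{u, v}} {V : Type w} (t : F.Term V) : Ctx F V := t.relabel some

section Positions

variable {F : FirstOrder.Language.{u, v}} {X : Type w'}

/-- The subterm of `t` at position `p`, or `none` if `p` is not a position of `t`. Arguments are
numbered from `0`. -/
def subtermAt : F.Term X → List ℕ → Option (F.Term X)
  | t, [] => some t
  | .var _, _ :: _ => none
  | .func (l := n) _ ts, i :: p => if h : i < n then subtermAt (ts ⟨i, h⟩) p else none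

/-- `replaceAt t p s` is `t[s]_p`, the result of replacing the subterm of `t` at position `p` by `s`
(used for positions `p` of `t` only). -/
def replaceAt : F.Term X → List ℕ → F.Term X → F.Term X
  | _, [], s => s
  | .var x, _ :: _, _ => .var x
  | .func f ts, i :: p, s =>
      .func f (fun j => if (j : ℕ) = i then replaceAt (ts j) p s else ts j)

/-- `p` is a position of `t`. -/
def IsPos (t : F.Term X) (p : List ℕ) : Prop := ∃ s, subtermAt t p = some s

/-- `p` is a position of `t` at which a function symbol of the signature occurs. -/
def IsFunPos (t : F.Term X) (p : List ℕ) : Prop :=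
  ∃ (n : ℕ) (f : F.Functions n) (ts : Fin n → F.Term X), subtermAt t p = some (.func f ts)

end Positions

section Rewriting

/-- A rewrite rule `lhs → rhs`: the left-hand side is not a variable, and every variable of the
right-hand side occurs in the left-hand side. -/
structure Rule (F : FirstOrder.Language.{u, v}) (V : Type w) where
  lhs : F.Term V
  rhs : F.Term V
  lhs_not_var : ∀ x : V, lhs ≠ .var x
  vars_subset : open Classical in rhs.varFinset ⊆ lhs.varFinset

/-- A term rewrite system over the signature `F` and the variables `V`: a set of rewrite rules. -/
abbrev TRS (F : FirstOrder.Language.{u, v}) (V : Type w) : Type (max u w) := Set (Rule F V)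

variable {F : FirstOrder.Language.{u, v}} {V : Type w} {X : Type w'}

/-- `s →_{p, ρ} t`: the rewrite step from `s` to `t` with the rule `ρ` at position `p`. It is used for
terms (`X = V`) and for contexts (`X = Option V`, where the hole is treated like a constant). -/
def StepAt (ρ : Rule F V) (p : List ℕ) (s t : F.Term X) : Prop :=
  ∃ σ : V → F.Term X,
    subtermAt s p = some (ρ.lhs.subst σ) ∧ t = replaceAt s p (ρ.rhs.subst σ)

/-- The rewrite relation on terms that is induced by `R`. -/
def Step (R : TRS F V) (s t : F.Term V) : Prop := ∃ ρ ∈ R, ∃ p, StepAt ρ p s t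

/-- A relation is confluent if any two elements that are reachable from a common element have a
common reduct. -/
def IsConfluent {α : Type w'} (r : α → α → Prop) : Prop :=
  ∀ a b c : α, Relation.ReflTransGen r a b → Relation.ReflTransGen r a c →
    ∃ d, Relation.ReflTransGen r b d ∧ Relation.ReflTransGen r c d

/-- A relation `r` is confluent on a set `S` if `S` is closed under `r` and the restriction
`r ∩ (S × S)` is confluent. -/
def IsConfluentOn {α : Type w'} (r : α → α → Prop) (S : Set α) : Prop :=
  (∀ a b, a ∈ S → r a b → b ∈ S) ∧ IsConfluent (fun a b => r a b ∧ a ∈ S ∧ b ∈ S)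

end Rewriting

section Layers

variable {F : FirstOrder.Language.{u, v}} {V : Type w}

/-- The order `⊑` on contexts: the smallest reflexive and transitive relation that is monotone and
has the hole below every context. -/
inductive Below : Ctx F V → Ctx F V → Prop
  | refl (C : Ctx F V) : Below C C
  | trans {C D E : Ctx F V} : Below C D → Below D E → Below C E
  | mono {n : ℕ} (f : F.Functions n) {Cs Ds : Fin n → Ctx F V} :
      (∀ i, Below (Cs i) (Ds i)) → Below (.func f Cs) (.func f Ds)
  | hole_below (C : Ctx F V) : Below hole C

/-- `E` is the supremum of `C` and `D` with respect to `⊑`, i.e. `C ⊔ D` is defined and equal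
to `E`. -/
def IsMerge (C D E : Ctx F V) : Prop :=
  Below C E ∧ Below D E ∧ ∀ E', Below C E' → Below D E' → Below E E'

/-- `T` is a top of `C` according to `𝕃`. -/
def IsTop (𝕃 : Set (Ctx F V)) (T C : Ctx F V) : Prop := T ∈ 𝕃 ∧ Below T C

/-- `M` is a max-top of `C`: a top that is maximal with respect to `⊑` among the tops of `C`. -/
def IsMaxTop (𝕃 : Set (Ctx F V)) (M C : Ctx F V) : Prop :=
  IsTop 𝕃 M C ∧ ∀ N, IsTop 𝕃 N C → Below M N → N = M

/-- Each term has a non-empty top. -/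
def CondL1 (𝕃 : Set (Ctx F V)) : Prop :=
  ∀ t : F.Term V, ∃ T, IsTop 𝕃 T (toCtx t) ∧ T ≠ hole

/-- `C[x]_p ∈ 𝕃` if and only if `C[□]_p ∈ 𝕃`. -/
def CondL2 (𝕃 : Set (Ctx F V)) : Prop :=
  ∀ (x : V) (C : Ctx F V) (p : List ℕ), IsPos C p →
    (replaceAt C p (ctxVar x) ∈ 𝕃 ↔ replaceAt C p hole ∈ 𝕃)

/-- If `L` and `N` are layers, a function symbol occurs at position `p` of `L`, and `L|_p ⊔ N` is
defined, then `L[L|_p ⊔ N]_p` is a layer. -/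
def CondL3 (𝕃 : Set (Ctx F V)) : Prop :=
  ∀ L ∈ 𝕃, ∀ N ∈ 𝕃, ∀ (p : List ℕ) (C E : Ctx F V), IsFunPos L p →
    subtermAt L p = some C → IsMerge C N E → replaceAt L p E ∈ 𝕃

/-- `𝕃` is a layer system. -/
structure IsLayerSystem (𝕃 : Set (Ctx F V)) : Prop where
  condL1 : CondL1 𝕃
  condL2 : CondL2 𝕃
  condL3 : CondL3 𝕃

/-- If `M` is a max-top of the term `s`, a function symbol occurs at position `p` of `M`, and
`s →_{p, ρ} t` for a rule `ρ` of `R`, then `M →_{p, ρ} L` for some layer `L`. -/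
def CondW (𝕃 : Set (Ctx F V)) (R : TRS F V) : Prop :=
  ∀ ρ ∈ R, ∀ (s t : F.Term V) (M : Ctx F V) (p : List ℕ),
    IsMaxTop 𝕃 M (toCtx s) → IsFunPos M p → StepAt ρ p s t →
      ∃ L ∈ 𝕃, StepAt ρ p M L

/-- In the situation of `CondW`, the layer `L` is a max-top of `t` or empty. (There is at most one
context `L` with `M →_{p, ρ} L`.) -/
def CondC1 (𝕃 : Set (Ctx F V)) (R : TRS F V) : Prop :=
  ∀ ρ ∈ R, ∀ (s t : F.Term V) (M : Ctx F V) (p : List ℕ),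
    IsMaxTop 𝕃 M (toCtx s) → IsFunPos M p → StepAt ρ p s t →
      ∀ L ∈ 𝕃, StepAt ρ p M L → IsMaxTop 𝕃 L (toCtx t) ∨ L = hole

/-- If `L ⊑ N` are layers and `p` is a hole position of `L` then `L[N|_p]_p` is a layer. -/
def CondC2 (𝕃 : Set (Ctx F V)) : Prop :=
  ∀ L ∈ 𝕃, ∀ N ∈ 𝕃, Below L N → ∀ (p : List ℕ) (C : Ctx F V),
    subtermAt L p = some hole → subtermAt N p = some C → replaceAt L p C ∈ 𝕃

/-- `R` is layered according to the layer system `𝕃`. -/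
structure IsLayered (𝕃 : Set (Ctx F V)) (R : TRS F V) : Prop where
  isLayerSystem : IsLayerSystem 𝕃
  condW : CondW 𝕃 R
  condC1 : CondC1 𝕃 R
  condC2 : CondC2 𝕃

/-- `HasRank 𝕃 t m` says that the term `t` has rank `m`. The aliens of `t = M[t₁, …, tₙ]`, where `M`
is the max-top of `t`, are the subterms of `t` at the hole positions of `M`; the rank of `t` is one
plus the maximum `m` of the ranks of its aliens, where the maximum of the empty set is `0`. Here
`k p` is the rank of the alien at the hole position `p`. -/
inductive HasRank (𝕃 : Set (Ctx F V)) : F.Term V → ℕ → Prop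
  | intro {t : F.Term V} {M : Ctx F V} {k : List ℕ → ℕ} {m : ℕ} :
      IsMaxTop 𝕃 M (toCtx t) →
      (∀ p a, subtermAt M p = some hole → subtermAt t p = some a → HasRank 𝕃 a (k p)) →
      (∀ p, subtermAt M p = some hole → k p ≤ m) →
      (m = 0 ∨ ∃ p, subtermAt M p = some hole ∧ k p = m) →
      HasRank 𝕃 t (1 + m)

end Layers

end LayerSystem

/-!
The proof is by induction on a bound for the rank. For a term `s` of rank at most `m + 2`, call the
aliens of rank greater than `m` tall, and hide them behind labels; the resulting labelled term is
the *base* of `s`. Replacing the labels injectively by fresh variables yields, by (L2), (C2) and the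
maximality of the max-top, a term of rank at most `m + 1`, so bases are confluent by induction.

By (W), (C1) and (C2) a step in the base of `s` either leads to the base of the result or collapses
it to a single tall alien. Tall aliens have rank at most `m + 1`, so they are confluent as well, and
they can be reduced consistently: finitely many confluent terms have reducts that agree whenever the
terms are joinable. Such balanced reductions send equal aliens to equal terms, and therefore commute
with base steps even if these duplicate or compare aliens; this is what replaces linearity. A base
reduction followed by a consistent reduction of tall aliens thus has the diamond property, and the
two sides of every rewrite step are joinable by it. Hence terms of rank at most `m + 2` are
confluent.
-/

namespace LayerSystem

open FirstOrder.Language (Term)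

section AbstractRewriting

open Relation

variable {α : Type*} {r q : α → α → Prop} {S : Set α} {a : α}

/-- Confluence of the relation `r` at the single point `a`. -/
def ConfluentAt (r : α → α → Prop) (a : α) : Prop :=
  ∀ b c, ReflTransGen r a b → ReflTransGen r a c → Join (ReflTransGen r) b c

theorem mem_of_reflTransGen (hS : ∀ a b, a ∈ S → r a b → b ∈ S) {a b : α} (ha : a ∈ S)
    (hab : ReflTransGen r a b) : b ∈ S := by
  induction hab with
  | refl => exact ha
  | tail _ hbc hb => exact hS _ _ hb hbc

theorem IsConfluentOn.confluentAt (h : IsConfluentOn r S) (ha : a ∈ S) : ConfluentAt r a := by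
  have hto {b : α} (hab : ReflTransGen r a b) :
      ReflTransGen (fun x y => r x y ∧ x ∈ S ∧ y ∈ S) a b := by
    induction hab with
    | refl => exact .refl
    | @tail b c hab hbc ih =>
      have hb := mem_of_reflTransGen h.1 ha hab
      exact ih.tail ⟨hbc, hb, h.1 b c hb hbc⟩
  intro b c hab hac
  obtain ⟨d, hbd, hcd⟩ := h.2 a b c (hto hab) (hto hac)
  exact ⟨d, .mono (fun _ _ h => h.1) _ _ hbd, .mono (fun _ _ h => h.1) _ _ hcd⟩

theorem confluentAt_of_diamond (hS : ∀ a b, a ∈ S → r a b → b ∈ S)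
    (hqr : ∀ a b, q a b → ReflTransGen r a b)
    (hdiamond : ∀ a ∈ S, ∀ b c, q a b → q a c → Join q b c)
    (hjoin : ∀ a ∈ S, ∀ b, r a b → Join q a b) (ha : a ∈ S) : ConfluentAt r a := by
  let q' (x y : α) : Prop := x ∈ S ∧ q x y
  have hq'r {x y : α} (hxy : ReflTransGen q' x y) : ReflTransGen r x y := by
    induction hxy with
    | refl => exact .refl
    | tail _ hyz ih => exact ih.trans (hqr _ _ hyz.2)
  have hcr {x y z : α} (hxy : ReflTransGen q' x y) (hxz : ReflTransGen q' x z) :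
      Join (ReflTransGen q') y z := by
    refine church_rosser (fun x y z hxy hxz => ?_) hxy hxz
    obtain ⟨u, hyu, hzu⟩ := hdiamond x hxy.1 y z hxy.2 hxz.2
    have hmem {y : α} (hxy : q' x y) : y ∈ S := mem_of_reflTransGen hS hxy.1 (hqr x y hxy.2)
    exact ⟨u, .single ⟨hmem hxy, hyu⟩, .single ⟨hmem hxz, hzu⟩⟩
  have hconv {b : α} (hab : ReflTransGen r a b) : Join (ReflTransGen q') a b := by
    induction hab with
    | refl => exact ⟨a, .refl, .refl⟩
    | @tail b c hab hbc ih =>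
      have hb := mem_of_reflTransGen hS ha hab
      obtain ⟨d, had, hbd⟩ := ih
      obtain ⟨e, hbe, hce⟩ := hjoin b hb c hbc
      obtain ⟨u, hdu, heu⟩ := hcr hbd (.single ⟨hb, hbe⟩)
      exact ⟨u, had.trans hdu, .head ⟨hS b c hb hbc, hce⟩ heu⟩
  intro b c hab hac
  obtain ⟨b', hab', hbb'⟩ := hconv hab
  obtain ⟨c', hac', hcc'⟩ := hconv hac
  obtain ⟨d, hbd, hcd⟩ := hcr hab' hac'
  exact ⟨d, hq'r (hbb'.trans hbd), hq'r (hcc'.trans hcd)⟩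

theorem ConfluentAt.join_trans (ha : ConfluentAt r a) {b c : α} (hab : Join (ReflTransGen r) a b)
    (hac : Join (ReflTransGen r) a c) : Join (ReflTransGen r) b c := by
  obtain ⟨d, had, hbd⟩ := hab
  obtain ⟨e, hae, hce⟩ := hac
  obtain ⟨u, hdu, heu⟩ := ha d e had hae
  exact ⟨u, hbd.trans hdu, hce.trans heu⟩

theorem ConfluentAt.exists_common_reduct (ha : ConfluentAt r a) {B : Set α} (hB : B.Finite)
    (h : ∀ b ∈ B, Join (ReflTransGen r) a b) :
    ∃ d, ReflTransGen r a d ∧ ∀ b ∈ B, ReflTransGen r b d := by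
  induction B, hB using Set.Finite.induction_on with
  | empty => exact ⟨a, .refl, by simp⟩
  | @insert b B _ _ ih =>
    obtain ⟨d, had, hBd⟩ := ih fun c hc => h c (Set.mem_insert_of_mem b hc)
    obtain ⟨e, hae, hbe⟩ := h b (Set.mem_insert b B)
    obtain ⟨u, hdu, heu⟩ := ha d e had hae
    refine ⟨u, had.trans hdu, ?_⟩
    rintro c (rfl | hc)
    · exact hbe.trans heu
    · exact (hBd c hc).trans hdu

theorem exists_balanced_reducts {A : Set α} (hA : A.Finite) (hconf : ∀ a ∈ A, ConfluentAt r a) :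
    ∃ ψ : α → α, (∀ a ∈ A, ReflTransGen r a (ψ a)) ∧
      ∀ a ∈ A, ∀ b ∈ A, Join (ReflTransGen r) a b → ψ a = ψ b := by
  let J := Join (ReflTransGen r)
  -- `ψ a` is chosen from the join class of `a` in `A`, hence is the same for joinable points.
  refine ⟨fun a => @Classical.epsilon _ ⟨a⟩ fun u => ∀ c ∈ A, J a c → ReflTransGen r c u, ?_, ?_⟩
  · intro a ha
    obtain ⟨u, _, hu⟩ := (hconf a ha).exists_common_reduct (B := {c ∈ A | J a c})
      (hA.subset fun _ h => h.1) fun _ h => h.2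
    exact @Classical.epsilon_spec _ (fun u => ∀ c ∈ A, J a c → ReflTransGen r c u)
      ⟨u, fun c hc hac => hu c ⟨hc, hac⟩⟩ a ha ⟨a, .refl, .refl⟩
  · intro a ha b hb hab
    have hclass (c : α) : J a c ↔ J b c :=
      ⟨(hconf a ha).join_trans hab, (hconf b hb).join_trans (Join.symm.symm a b hab)⟩
    simp only [hclass]

end AbstractRewriting

section Terms

variable {F : FirstOrder.Language.{u, v}} {V X Y Z : Type*}

theorem subtermAt_nil (t : F.Term X) : subtermAt t [] = some t := by cases t <;> rfl

theorem subtermAt_func_cons {n : ℕ} (f : F.Functions n) (ts : Fin n → F.Term X) (i : Fin n)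
    (p : List ℕ) : subtermAt (.func f ts) ((i : ℕ) :: p) = subtermAt (ts i) p := by
  simp [subtermAt]

theorem replaceAt_nil (t s : F.Term X) : replaceAt t [] s = s := by cases t <;> rfl

theorem replaceAt_func_cons {n : ℕ} (f : F.Functions n) (ts : Fin n → F.Term X) (i : Fin n)
    (p : List ℕ) (s : F.Term X) :
    replaceAt (.func f ts) ((i : ℕ) :: p) s =
      .func f (Function.update ts i (replaceAt (ts i) p s)) := by
  simp only [replaceAt, Term.func.injEq, heq_eq_eq, true_and]
  funext j
  rcases eq_or_ne j i with rfl | hj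
  · simp
  · simp [hj, Fin.val_inj]

theorem exists_func_of_subtermAt_cons {t s : F.Term X} {j : ℕ} {p : List ℕ}
    (h : subtermAt t (j :: p) = some s) :
    ∃ (n : ℕ) (f : F.Functions n) (ts : Fin n → F.Term X) (i : Fin n),
      t = .func f ts ∧ j = i ∧ subtermAt (ts i) p = some s := by
  cases t with
  | var x => simp [subtermAt] at h
  | @func n f ts =>
    by_cases hj : j < n
    · exact ⟨n, f, ts, ⟨j, hj⟩, rfl, rfl, by simpa [subtermAt, hj] using h⟩
    · simp [subtermAt, hj] at h

@[elab_as_elim]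
theorem subtermAt_induction {s : F.Term X} {P : ∀ t p, subtermAt t p = some s → Prop}
    (nil : P s [] (subtermAt_nil s))
    (cons : ∀ {n : ℕ} (f : F.Functions n) (ts : Fin n → F.Term X) (i : Fin n) (p : List ℕ)
      (hi : subtermAt (ts i) p = some s), P (ts i) p hi →
        P (.func f ts) (i :: p) ((subtermAt_func_cons f ts i p).trans hi))
    {t : F.Term X} {p : List ℕ} (h : subtermAt t p = some s) : P t p h := by
  induction p generalizing t with
  | nil =>
    obtain rfl : t = s := by rwa [subtermAt_nil, Option.some_inj] at h
    exact nil
  | cons j p ih =>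
    obtain ⟨n, f, ts, i, rfl, rfl, hi⟩ := exists_func_of_subtermAt_cons h
    exact cons f ts i p hi (ih hi)

theorem subtermAt_append (t : F.Term X) (p q : List ℕ) :
    subtermAt t (p ++ q) = (subtermAt t p).bind fun s => subtermAt s q := by
  induction p generalizing t with
  | nil => simp [subtermAt_nil]
  | cons i p ih =>
    cases t with
    | var x => rfl
    | @func n f ts =>
      by_cases hi : i < n
      · simpa [subtermAt, hi] using ih (ts ⟨i, hi⟩)
      · simp [subtermAt, hi]

theorem subtermAt_subst {t s : F.Term X} {p : List ℕ} (h : subtermAt t p = some s)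
    (θ : X → F.Term Y) : subtermAt (t.subst θ) p = some (s.subst θ) := by
  induction h using subtermAt_induction with
  | nil => exact subtermAt_nil _
  | cons f ts i p _ ih => exact (subtermAt_func_cons f _ i p).trans ih

theorem replaceAt_subst {t s : F.Term X} {p : List ℕ} (h : subtermAt t p = some s)
    (u : F.Term X) (θ : X → F.Term Y) :
    (replaceAt t p u).subst θ = replaceAt (t.subst θ) p (u.subst θ) := by
  induction h using subtermAt_induction with
  | nil => simp only [replaceAt_nil]
  | cons f ts i p _ ih =>
    simp only [replaceAt_func_cons, Term.subst, Term.func.injEq, heq_eq_eq, true_and, ← ih]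
    exact Function.comp_update (fun t : F.Term X => t.subst θ) ts i _

theorem replaceAt_append {t s : F.Term X} {p : List ℕ} (h : subtermAt t p = some s) (q : List ℕ)
    (u : F.Term X) : replaceAt t (p ++ q) u = replaceAt t p (replaceAt s q u) := by
  induction h using subtermAt_induction with
  | nil => simp [replaceAt_nil]
  | cons f ts i p _ ih => simp [replaceAt_func_cons, ih]

theorem replaceAt_self {t s : F.Term X} {p : List ℕ} (h : subtermAt t p = some s) :
    replaceAt t p s = t := by
  induction h using subtermAt_induction with
  | nil => exact replaceAt_nil _ _
  | cons f ts i p _ ih => rw [replaceAt_func_cons, ih, Function.update_eq_self]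

theorem subtermAt_replaceAt {t s : F.Term X} {p : List ℕ} (h : subtermAt t p = some s)
    (u : F.Term X) : subtermAt (replaceAt t p u) p = some u := by
  induction h using subtermAt_induction with
  | nil => rw [replaceAt_nil, subtermAt_nil]
  | cons f ts i p _ ih => rw [replaceAt_func_cons, subtermAt_func_cons, Function.update_self, ih]

theorem subst_subst (t : F.Term X) (θ : X → F.Term Y) (η : Y → F.Term Z) :
    (t.subst θ).subst η = t.subst fun x => (θ x).subst η := by
  induction t with
  | var x => rfl
  | func f ts ih => simp only [Term.subst, ih]

theorem subst_var (t : F.Term X) : t.subst Term.var = t := by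
  induction t with
  | var x => rfl
  | func f ts ih => simp only [Term.subst, ih]

/-- The set of variables that occur in a term; unlike `varFinset` it does not need decidable
equality of variables. -/
def vars (t : F.Term X) : Set X := open Classical in ↑t.varFinset

@[simp] theorem mem_vars_var {x y : X} : y ∈ vars (.var x : F.Term X) ↔ y = x := by simp [vars]

@[simp] theorem mem_vars_func {n : ℕ} {f : F.Functions n} {ts : Fin n → F.Term X} {y : X} :
    y ∈ vars (.func f ts) ↔ ∃ i, y ∈ vars (ts i) := by simp [vars]

theorem finite_vars (t : F.Term X) : (vars t).Finite := Finset.finite_toSet _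

theorem Rule.vars_rhs_subset (ρ : Rule F V) : vars ρ.rhs ⊆ vars ρ.lhs :=
  Finset.coe_subset.2 ρ.vars_subset

theorem mem_vars_subst {t : F.Term X} {θ : X → F.Term Y} {y : Y} :
    y ∈ vars (t.subst θ) ↔ ∃ x ∈ vars t, y ∈ vars (θ x) := by
  induction t with
  | var x => simp
  | func f ts ih => simp only [Term.subst, mem_vars_func, ih]; tauto

theorem eq_of_subst_eq {t : F.Term X} {θ η : X → F.Term Y} (h : t.subst θ = t.subst η) :
    ∀ x ∈ vars t, θ x = η x := by
  induction t with
  | var x => simpa using h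
  | func f ts ih =>
    intro x hx
    obtain ⟨i, hi⟩ := mem_vars_func.1 hx
    simp only [Term.subst, Term.func.injEq, heq_eq_eq, true_and] at h
    exact ih i (congrFun h i) x hi

theorem vars_subset_of_subtermAt {t s : F.Term X} {p : List ℕ} (h : subtermAt t p = some s) :
    vars s ⊆ vars t := by
  induction h using subtermAt_induction with
  | nil => exact subset_rfl
  | cons f ts i _ _ ih => exact fun x hx => mem_vars_func.2 ⟨i, ih hx⟩

theorem vars_replaceAt_subset {t s : F.Term X} {p : List ℕ} (h : subtermAt t p = some s)
    (u : F.Term X) : vars (replaceAt t p u) ⊆ vars t ∪ vars u := by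
  induction h using subtermAt_induction with
  | nil => simp [replaceAt_nil]
  | cons f ts i p _ ih =>
    intro x hx
    rw [replaceAt_func_cons] at hx
    obtain ⟨k, hk⟩ := mem_vars_func.1 hx
    rcases eq_or_ne k i with rfl | hki
    · rw [Function.update_self] at hk
      exact (ih hk).imp_left fun hx => mem_vars_func.2 ⟨k, hx⟩
    · rw [Function.update_of_ne hki] at hk
      exact Or.inl (mem_vars_func.2 ⟨k, hk⟩)

theorem not_isFunPos_var (x : X) (p : List ℕ) : ¬ IsFunPos (.var x : F.Term X) p := by
  rintro ⟨n, f, ts, h⟩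
  cases p <;> simp [subtermAt] at h

/-- The number of occurrences of function symbols in a term plus the sum of the weights of the
variables at its leaves. -/
def weight (w : X → ℕ) : F.Term X → ℕ
  | .var x => w x
  | .func _ ts => 1 + ∑ i, weight w (ts i)

theorem weight_subst (w : Y → ℕ) (t : F.Term X) (θ : X → F.Term Y) :
    weight w (t.subst θ) = weight (fun x => weight w (θ x)) t := by
  induction t with
  | var x => rfl
  | func f ts ih => simp only [Term.subst, weight, ih]

theorem weight_arg_lt {w : X → ℕ} {n : ℕ} (f : F.Functions n) (ts : Fin n → F.Term X) (i : Fin n) :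
    weight w (ts i) < weight w (.func f ts) := by
  have := Finset.single_le_sum (fun j _ => Nat.zero_le (weight w (ts j))) (Finset.mem_univ i)
  simp only [weight]
  omega

theorem le_weight_of_mem_vars {w : X → ℕ} {t : F.Term X} {x : X} (hx : x ∈ vars t) :
    w x ≤ weight w t := by
  induction t with
  | var y => rw [mem_vars_var.1 hx, weight]
  | func f ts ih =>
    obtain ⟨i, hi⟩ := mem_vars_func.1 hx
    exact (ih i hi).trans (weight_arg_lt f ts i).le

/-- A relation between terms that is closed under the application of function symbols. -/
def IsCompatible (Q : F.Term X → F.Term Y → Prop) : Prop :=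
  ∀ ⦃n : ℕ⦄ (f : F.Functions n) ⦃ts : Fin n → F.Term X⦄ ⦃us : Fin n → F.Term Y⦄,
    (∀ i, Q (ts i) (us i)) → Q (.func f ts) (.func f us)

theorem isCompatible_eq : IsCompatible (Eq : F.Term X → F.Term X → Prop) :=
  fun _ f _ _ h => congrArg (Term.func f) (funext h)

theorem isCompatible_isFunPos :
    IsCompatible fun (t : F.Term X) (u : F.Term Y) => ∀ p, IsFunPos t p → IsFunPos u p := by
  rintro n f ts us h (_ | ⟨j, p⟩) ⟨_, g, vs, hp⟩
  · exact ⟨n, f, us, subtermAt_nil _⟩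
  · obtain ⟨_, _, _, i, e, rfl, hi⟩ := exists_func_of_subtermAt_cons hp
    cases e
    simpa only [IsFunPos, subtermAt_func_cons] using h i p ⟨_, g, vs, hi⟩

theorem IsCompatible.subst {Q : F.Term Y → F.Term Z → Prop} (hQ : IsCompatible Q) {t : F.Term X}
    {θ : X → F.Term Y} {η : X → F.Term Z} (h : ∀ x ∈ vars t, Q (θ x) (η x)) :
    Q (t.subst θ) (t.subst η) := by
  induction t with
  | var x => exact h x (mem_vars_var.2 rfl)
  | func f ts ih => exact hQ f fun i => ih i fun x hx => h x (mem_vars_func.2 ⟨i, hx⟩)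

theorem subst_congr {t : F.Term X} {θ η : X → F.Term Y} (h : ∀ x ∈ vars t, θ x = η x) :
    t.subst θ = t.subst η :=
  isCompatible_eq.subst h

end Terms

section RelSubst

variable {F : FirstOrder.Language.{u, v}} {X Y Z : Type*} {r r' : X → F.Term Y → Prop}
  {t : F.Term X} {u : F.Term Y}

/-- Substitution along a relation: `RelSubst r t u` means that `u` arises from `t` by replacing each
occurrence of a variable `x` by a term that is related to `x` by `r`; different occurrences of the
same variable may be replaced by different terms. -/
inductive RelSubst (r : X → F.Term Y → Prop) : F.Term X → F.Term Y → Prop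
  | var {x : X} {u : F.Term Y} : r x u → RelSubst r (.var x) u
  | func {n : ℕ} (f : F.Functions n) {ts : Fin n → F.Term X} {us : Fin n → F.Term Y} :
      (∀ i, RelSubst r (ts i) (us i)) → RelSubst r (.func f ts) (.func f us)

theorem isCompatible_relSubst (r : X → F.Term Y → Prop) : IsCompatible (RelSubst r) :=
  fun _ f _ _ => .func f

theorem relSubst_var_iff {x : X} : RelSubst r (.var x) u ↔ r x u :=
  ⟨fun | .var h => h, .var⟩

theorem relSubst_func_iff {n : ℕ} {f : F.Functions n} {ts : Fin n → F.Term X} :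
    RelSubst r (.func f ts) u ↔ ∃ us, u = .func f us ∧ ∀ i, RelSubst r (ts i) (us i) :=
  ⟨fun | .func _ h => ⟨_, rfl, h⟩, fun ⟨_, hu, h⟩ => hu ▸ .func f h⟩

theorem RelSubst.exists_subtermAt (h : RelSubst r t u) {a : F.Term X} {q : List ℕ}
    (ha : subtermAt t q = some a) : ∃ b, subtermAt u q = some b ∧ RelSubst r a b := by
  induction ha using subtermAt_induction generalizing u with
  | nil => exact ⟨u, subtermAt_nil u, h⟩
  | cons f ts i p _ ih =>
    obtain ⟨us, rfl, hus⟩ := relSubst_func_iff.1 h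
    rw [subtermAt_func_cons]
    exact ih (hus i)

theorem RelSubst.isFunPos_or (h : RelSubst r t u) {p : List ℕ} (hp : IsPos u p) :
    IsFunPos t p ∨ ∃ q p' x, p = q ++ p' ∧ subtermAt t q = some (.var x) := by
  induction h generalizing p with
  | @var x u _ => exact Or.inr ⟨[], p, x, rfl, subtermAt_nil _⟩
  | @func n f ts us _ ih =>
    obtain ⟨s, hs⟩ := hp
    cases p with
    | nil => exact Or.inl ⟨n, f, ts, subtermAt_nil _⟩
    | cons j p =>
      obtain ⟨_, _, _, i, e, rfl, hi⟩ := exists_func_of_subtermAt_cons hs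
      cases e
      rcases ih i ⟨s, hi⟩ with hp | ⟨q, p', x, rfl, hq⟩
      · exact Or.inl (by simpa only [IsFunPos, subtermAt_func_cons] using hp)
      · exact Or.inr ⟨i :: q, p', x, rfl, by rwa [subtermAt_func_cons]⟩

theorem RelSubst.replaceAt (h : RelSubst r t u) {a K : F.Term X} {d : F.Term Y} {q : List ℕ}
    (ha : subtermAt t q = some a) (hK : RelSubst r K d) :
    RelSubst r (replaceAt t q K) (replaceAt u q d) := by
  induction ha using subtermAt_induction generalizing u with
  | nil => rwa [replaceAt_nil, replaceAt_nil]
  | cons f ts i p _ ih =>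
    obtain ⟨us, rfl, hus⟩ := relSubst_func_iff.1 h
    rw [replaceAt_func_cons, replaceAt_func_cons]
    refine .func f fun k => ?_
    rcases eq_or_ne k i with rfl | hki
    · simpa only [Function.update_self] using ih (hus k)
    · simpa only [Function.update_of_ne hki] using hus k

theorem RelSubst.imp_subtermAt (h : RelSubst r t u)
    (hr : ∀ q x w, subtermAt t q = some (.var x) → subtermAt u q = some w → r x w → r' x w) :
    RelSubst r' t u := by
  induction h with
  | var hx => exact .var (hr [] _ _ (subtermAt_nil _) (subtermAt_nil _) hx)
  | func f _ ih =>
    refine .func f fun i => ih i fun q x w ht hu => hr (i :: q) x w ?_ ?_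
    · rwa [subtermAt_func_cons]
    · rwa [subtermAt_func_cons]

theorem RelSubst.imp_vars (h : RelSubst r t u)
    (hr : ∀ x ∈ vars t, ∀ w, vars w ⊆ vars u → r x w → r' x w) : RelSubst r' t u :=
  h.imp_subtermAt fun _ x w ht hu =>
    hr x (vars_subset_of_subtermAt ht (mem_vars_var.2 rfl)) w (vars_subset_of_subtermAt hu)

theorem RelSubst.exists_subtermAt_of_mem_vars (h : RelSubst r t u) {y : Y} (hy : y ∈ vars u) :
    ∃ q x w, subtermAt t q = some (.var x) ∧ subtermAt u q = some w ∧ r x w ∧ y ∈ vars w := by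
  induction h with
  | @var x u hx => exact ⟨[], x, u, subtermAt_nil _, subtermAt_nil _, hx, hy⟩
  | func f _ ih =>
    obtain ⟨i, hi⟩ := mem_vars_func.1 hy
    obtain ⟨q, x, w, ht, hu, hx, hy⟩ := ih i hi
    refine ⟨i :: q, x, w, ?_, ?_, hx, hy⟩
    · rwa [subtermAt_func_cons]
    · rwa [subtermAt_func_cons]

theorem RelSubst.subst {Z' : Type*} {Q : F.Term Z → F.Term Z' → Prop} (h : RelSubst r t u)
    (hQ : IsCompatible Q) {θ : X → F.Term Z} {η : Y → F.Term Z'}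
    (hr : ∀ x w, r x w → Q (θ x) (w.subst η)) : Q (t.subst θ) (u.subst η) := by
  induction h with
  | var hx => exact hr _ _ hx
  | func f _ ih => exact hQ f ih

theorem RelSubst.exists_relSubst {Z' : Type*} {Q : F.Term Z → F.Term Z' → Prop}
    {r' : X → F.Term Z' → Prop} (h : RelSubst r t u) (hQ : IsCompatible Q) {η : Y → F.Term Z}
    (hr : ∀ x ∈ vars t, ∀ w, r x w → ∃ d, r' x d ∧ Q (w.subst η) d) :
    ∃ d, RelSubst r' t d ∧ Q (u.subst η) d := by
  induction h with
  | @var x u hx =>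
    obtain ⟨d, hd, hQd⟩ := hr x (mem_vars_var.2 rfl) u hx
    exact ⟨d, .var hd, hQd⟩
  | func f _ ih =>
    choose ds hds hQds using fun i => ih i fun x hx => hr x (mem_vars_func.2 ⟨i, hx⟩)
    exact ⟨.func f ds, .func f hds, hQ f hQds⟩

end RelSubst

section Rewriting

variable {F : FirstOrder.Language.{u, v}} {V X Y : Type*} {R : TRS F V} {ρ : Rule F V}
  {p q : List ℕ} {s t a b : F.Term X}

theorem StepAt.subst (h : StepAt ρ p s t) (θ : X → F.Term Y) :
    StepAt ρ p (s.subst θ) (t.subst θ) := by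
  obtain ⟨σ, hs, rfl⟩ := h
  refine ⟨fun x => (σ x).subst θ, ?_, ?_⟩
  · rw [subtermAt_subst hs, subst_subst]
  · rw [replaceAt_subst hs, subst_subst]

theorem StepAt.unique {t' : F.Term X} (h : StepAt ρ p s t) (h' : StepAt ρ p s t') : t = t' := by
  obtain ⟨σ, hs, rfl⟩ := h
  obtain ⟨σ', hs', rfl⟩ := h'
  have hσ := eq_of_subst_eq (Option.some.inj (hs.symm.trans hs'))
  rw [subst_congr fun x hx => hσ x (ρ.vars_rhs_subset hx)]

theorem StepAt.vars_subset (h : StepAt ρ p s t) : vars t ⊆ vars s := by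
  obtain ⟨σ, hs, rfl⟩ := h
  refine (vars_replaceAt_subset hs _).trans (Set.union_subset subset_rfl ?_)
  refine subset_trans (fun x hx => ?_) (vars_subset_of_subtermAt hs)
  obtain ⟨y, hy, hx⟩ := mem_vars_subst.1 hx
  exact mem_vars_subst.2 ⟨y, ρ.vars_rhs_subset hy, hx⟩

theorem StepAt.isFunPos (h : StepAt ρ p s t) : IsFunPos s p := by
  obtain ⟨σ, hs, rfl⟩ := h
  cases hl : ρ.lhs with
  | var x => exact absurd hl (ρ.lhs_not_var x)
  | func f ts => exact ⟨_, f, _, by rw [hs, hl]; rfl⟩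

theorem StepAt.of_append (h : StepAt ρ (q ++ p) s t) (ha : subtermAt s q = some a) :
    ∃ a', StepAt ρ p a a' ∧ t = replaceAt s q a' := by
  obtain ⟨σ, hs, rfl⟩ := h
  rw [subtermAt_append, ha] at hs
  exact ⟨_, ⟨σ, hs, rfl⟩, replaceAt_append ha _ _⟩

theorem StepAt.append (h : StepAt ρ p a b) (ha : subtermAt s q = some a) :
    StepAt ρ (q ++ p) s (replaceAt s q b) := by
  obtain ⟨σ, hs, rfl⟩ := h
  exact ⟨σ, by rwa [subtermAt_append, ha], (replaceAt_append ha _ _).symm⟩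

/-- The rewrite relation induced by `R` on terms over an arbitrary set of variables; on terms over
`V` it is `Step R`. -/
def Rewrites (R : TRS F V) (s t : F.Term X) : Prop := ∃ ρ ∈ R, ∃ p, StepAt ρ p s t

/-- Reduction in any number of steps, on terms over an arbitrary set of variables. -/
abbrev Reduces (R : TRS F V) : F.Term X → F.Term X → Prop := Relation.ReflTransGen (Rewrites R)

theorem Rewrites.subst (h : Rewrites R s t) (θ : X → F.Term Y) :
    Rewrites R (s.subst θ) (t.subst θ) := by
  obtain ⟨ρ, hρ, p, h⟩ := h
  exact ⟨ρ, hρ, p, h.subst θ⟩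

theorem Rewrites.vars_subset (h : Rewrites R s t) : vars t ⊆ vars s := by
  obtain ⟨ρ, _, p, h⟩ := h
  exact h.vars_subset

theorem not_rewrites_var {x : X} : ¬ Rewrites R (.var x) t := by
  rintro ⟨ρ, _, p, h⟩
  exact not_isFunPos_var x p h.isFunPos

theorem Rewrites.replaceAt (h : Rewrites R a b) (ha : subtermAt s q = some a) :
    Rewrites R s (replaceAt s q b) := by
  obtain ⟨ρ, hρ, p, h⟩ := h
  exact ⟨ρ, hρ, q ++ p, h.append ha⟩

theorem Reduces.subst (h : Reduces R s t) (θ : X → F.Term Y) :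
    Reduces R (s.subst θ) (t.subst θ) :=
  Relation.ReflTransGen.lift (fun s : F.Term X => s.subst θ) (fun _ _ h => h.subst θ) _ _ h

theorem Reduces.vars_subset (h : Reduces R s t) : vars t ⊆ vars s := by
  induction h with
  | refl => exact subset_rfl
  | tail _ h ih => exact h.vars_subset.trans ih

theorem Reduces.func_update {n : ℕ} (f : F.Functions n) (ts : Fin n → F.Term X) (i : Fin n)
    (h : Reduces R a b) :
    Reduces R (.func f (Function.update ts i a)) (.func f (Function.update ts i b)) := by
  refine Relation.ReflTransGen.lift (p := Rewrites R)
    (fun a => Term.func f (Function.update ts i a)) (fun a b hab => ?_) _ _ h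
  have hi : subtermAt (Term.func f (Function.update ts i a)) [(i : ℕ)] = some a := by
    rw [subtermAt_func_cons, Function.update_self, subtermAt_nil]
  have := hab.replaceAt hi
  rwa [replaceAt_func_cons, Function.update_idem, Function.update_self, replaceAt_nil] at this

theorem update_induction {ι α : Type*} [Finite ι] [DecidableEq ι] {P : (ι → α) → Prop}
    {a b : ι → α} (ha : P a) (hstep : ∀ c i, c i = a i → P c → P (Function.update c i (b i))) :
    P b := by
  have := Fintype.ofFinite ι
  suffices H : ∀ S : Finset ι, P (S.piecewise b a) by simpa using H Finset.univ
  intro S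
  induction S using Finset.induction_on with
  | empty => simpa using ha
  | insert i S hi ih =>
    rw [Finset.piecewise_insert]
    exact hstep _ i (Finset.piecewise_eq_of_notMem S b a hi) ih

theorem isCompatible_reduces (R : TRS F V) :
    IsCompatible (Reduces R : F.Term X → F.Term X → Prop) := by
  intro n f ts us h
  refine update_induction (P := fun vs => Reduces R (.func f ts) (.func f vs)) .refl
    fun vs i hi hvs => hvs.trans ?_
  have := Reduces.func_update f vs i (h i)
  rwa [← hi, Function.update_eq_self] at this

end Rewriting

section Order

variable {F : FirstOrder.Language.{u, v}} {V : Type w} {C D M K c d : Ctx F V} {s a : F.Term V}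
  {q : List ℕ}

theorem below_iff_relSubst : Below C D ↔ RelSubst (fun x D => x = none ∨ D = .var x) C D := by
  have hrefl (C : Ctx F V) : RelSubst (fun x D => x = none ∨ D = .var x) C C := by
    induction C with
    | var x => exact .var (Or.inr rfl)
    | func f _ ih => exact .func f ih
  refine ⟨fun h => ?_, fun h => ?_⟩
  · induction h with
    | refl C => exact hrefl C
    | hole_below D => exact .var (Or.inl rfl)
    | mono f _ ih => exact .func f ih
    | @trans C D E _ _ hCD hDE =>
      clear * - hCD hDE
      induction hCD generalizing E with
      | var h =>
        rcases h with rfl | rfl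
        · exact .var (Or.inl rfl)
        · exact hDE
      | func f _ ih =>
        obtain ⟨Es, rfl, hEs⟩ := relSubst_func_iff.1 hDE
        exact .func f fun i => ih i (hEs i)
  · induction h with
    | var h =>
      rcases h with rfl | rfl
      · exact .hole_below _
      · exact .refl _
    | func f _ ih => exact .mono f ih

theorem ctxVar_below_iff {x : V} : Below (ctxVar x) D ↔ D = ctxVar x := by
  simp [below_iff_relSubst, ctxVar, relSubst_var_iff]

theorem func_below_iff {n : ℕ} {f : F.Functions n} {Cs : Fin n → Ctx F V} :
    Below (.func f Cs) D ↔ ∃ Ds, D = .func f Ds ∧ ∀ i, Below (Cs i) (Ds i) := by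
  simp only [below_iff_relSubst, relSubst_func_iff]

theorem below_func_iff {n : ℕ} {f : F.Functions n} {Ds : Fin n → Ctx F V} :
    Below C (.func f Ds) ↔ C = hole ∨ ∃ Cs, C = .func f Cs ∧ ∀ i, Below (Cs i) (Ds i) := by
  constructor
  · intro h
    cases C with
    | var x =>
      rcases relSubst_var_iff.1 (below_iff_relSubst.1 h) with rfl | h
      · exact Or.inl rfl
      · cases h
    | func g Cs =>
      obtain ⟨Ds', h, hC⟩ := func_below_iff.1 h
      cases h
      exact Or.inr ⟨Cs, rfl, hC⟩
  · rintro (rfl | ⟨Cs, rfl, h⟩)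
    · exact .hole_below _
    · exact .mono f h

/-- The number of positions of a context that are not holes, a size for which `⊑` is strictly
monotone. -/
def ctxSize : Ctx F V → ℕ := weight fun x => x.elim 0 fun _ => 1

theorem Below.ctxSize_le (h : Below C D) : ctxSize C ≤ ctxSize D := by
  induction h with
  | refl => exact le_rfl
  | trans _ _ hCD hDE => exact hCD.trans hDE
  | hole_below => exact Nat.zero_le _
  | mono _ _ ih => exact Nat.add_le_add_left (Finset.sum_le_sum fun i _ => ih i) 1

theorem Below.eq_of_ctxSize_le (h : Below C D) (hD : ctxSize D ≤ ctxSize C) : C = D := by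
  induction below_iff_relSubst.1 h with
  | @var x D hx =>
    rcases hx with rfl | rfl
    · rcases D with (_ | x) | f
      · rfl
      all_goals simp [ctxSize, weight] at hD
    · rfl
  | @func n f Cs Ds hs ih =>
    have hle (i : Fin n) : ctxSize (Cs i) ≤ ctxSize (Ds i) :=
      (below_iff_relSubst.2 (hs i)).ctxSize_le
    have hsum : ∑ i, ctxSize (Cs i) = ∑ i, ctxSize (Ds i) :=
      le_antisymm (Finset.sum_le_sum fun i _ => hle i) (Nat.le_of_add_le_add_left hD)
    have heq := (Finset.sum_eq_sum_iff_of_le fun i _ => hle i).1 hsum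
    exact congrArg _ <| funext fun i =>
      ih i (below_iff_relSubst.2 (hs i)) (heq i (Finset.mem_univ i)).ge

theorem Below.antisymm (h : Below C D) (h' : Below D C) : C = D :=
  h.eq_of_ctxSize_le h'.ctxSize_le

theorem exists_isMerge {Z : Ctx F V} (hC : Below C Z) (hD : Below D Z) :
    ∃ E, IsMerge C D E ∧ Below E Z := by
  induction C generalizing D Z with
  | var x =>
    cases x with
    | none => exact ⟨D, ⟨.hole_below _, .refl _, fun _ _ h => h⟩, hD⟩
    | some x =>
      obtain rfl := ctxVar_below_iff.1 hC
      exact ⟨_, ⟨.refl _, hD, fun _ h _ => h⟩, .refl _⟩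
  | func f Cs ih =>
    obtain ⟨Zs, rfl, hCs⟩ := func_below_iff.1 hC
    rcases below_func_iff.1 hD with rfl | ⟨Ds, rfl, hDs⟩
    · exact ⟨_, ⟨.refl _, .hole_below _, fun _ h _ => h⟩, hC⟩
    · choose Es hE hEZ using fun i => ih i (hCs i) (hDs i)
      refine ⟨.func f Es, ⟨.mono f fun i => (hE i).1, .mono f fun i => (hE i).2.1, ?_⟩, .mono f hEZ⟩
      intro E' hC' hD'
      obtain ⟨Es', rfl, hCs'⟩ := func_below_iff.1 hC'
      obtain ⟨_, h, hDs'⟩ := func_below_iff.1 hD'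
      cases h
      exact .mono f fun i => (hE i).2.2 _ (hCs' i) (hDs' i)

theorem Below.exists_subtermAt (h : Below C D) (hc : subtermAt C q = some c) :
    ∃ d, subtermAt D q = some d ∧ Below c d := by
  simpa only [below_iff_relSubst] using (below_iff_relSubst.1 h).exists_subtermAt hc

/-- `M` is obtained from the term `s` by replacing some subterms by holes. -/
def Fits (M : Ctx F V) (s : F.Term V) : Prop := Below M (toCtx s)

theorem fits_iff_relSubst :
    Fits M s ↔ RelSubst (fun x t => ∀ y, x = some y → t = .var y) M s := by
  induction M generalizing s with
  | var x =>
    rw [relSubst_var_iff]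
    cases x with
    | none => exact iff_of_true (.hole_below _) nofun
    | some x =>
      have h : Fits (ctxVar x) s ↔ s = .var x := by
        rw [Fits, ctxVar_below_iff]
        cases s <;> simp [toCtx, ctxVar]
      simpa [ctxVar] using h
  | func f Cs ih =>
    simp only [relSubst_func_iff, ← ih]
    rw [Fits, func_below_iff]
    constructor
    · rintro ⟨Ds, h, hDs⟩
      cases s with
      | var x => cases h
      | func g ts => cases h; exact ⟨ts, rfl, hDs⟩
    · rintro ⟨ts, rfl, hts⟩
      exact ⟨_, rfl, hts⟩

theorem hole_fits (s : F.Term V) : Fits hole s := .hole_below _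

theorem ctxVar_fits_iff {x : V} : Fits (ctxVar x) s ↔ s = .var x := by
  simp [fits_iff_relSubst, ctxVar, relSubst_var_iff]

theorem func_fits_iff {n : ℕ} {f : F.Functions n} {Cs : Fin n → Ctx F V} :
    Fits (.func f Cs) s ↔ ∃ ts, s = .func f ts ∧ ∀ i, Fits (Cs i) (ts i) := by
  simp only [fits_iff_relSubst, relSubst_func_iff]

theorem Fits.exists_subtermAt (h : Fits M s) (hC : subtermAt M q = some C) :
    ∃ a, subtermAt s q = some a ∧ Fits C a := by
  simpa only [fits_iff_relSubst] using (fits_iff_relSubst.1 h).exists_subtermAt hC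

theorem Fits.replaceAt {b : F.Term V} (h : Fits M s) (hC : subtermAt M q = some C)
    (hK : Fits K b) : Fits (replaceAt M q K) (replaceAt s q b) :=
  fits_iff_relSubst.2 ((fits_iff_relSubst.1 h).replaceAt hC (fits_iff_relSubst.1 hK))

theorem Fits.replaceAt_left (h : Fits M s) (hC : subtermAt M q = some C)
    (ha : subtermAt s q = some a) (hK : Fits K a) : Fits (LayerSystem.replaceAt M q K) s := by
  simpa only [replaceAt_self ha] using h.replaceAt hC hK

end Order

section Labels

variable {F : FirstOrder.Language.{u, v}} {V : Type w} {Y : Type*} {M C K : Ctx F V}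
  {s a b : F.Term V} {p : List ℕ}

/-- Labelled terms: terms in which some subterms may be hidden. The variable `.inr a` is a label
that stands for the term `a`. -/
abbrev LTerm (F : FirstOrder.Language.{u, v}) (V : Type w) : Type (max u w) :=
  F.Term (V ⊕ F.Term V)

/-- The term represented by a labelled term: each label is replaced by the term it stands for. -/
def val (E : LTerm F V) : F.Term V := E.subst (Sum.elim .var id)

/-- The visible part of a labelled term: each label is replaced by a hole. -/
def shape (E : LTerm F V) : Ctx F V := E.subst (Sum.elim ctxVar fun _ => hole)

/-- A term, seen as a labelled term without labels. -/
def unlabelled (t : F.Term V) : LTerm F V := t.subst fun x => .var (.inl x)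

/-- The labelled term obtained from the context `M` by writing into each hole the subterm of `s`
at the same position. It is meaningful only if `M` fits `s`. -/
def labelHoles : Ctx F V → F.Term V → LTerm F V
  | .var none, s => .var (.inr s)
  | .var (some x), _ => .var (.inl x)
  | .func f Cs, s => .func f fun i => labelHoles (Cs i) ((subtermAt s [i]).getD s)

theorem labelHoles_hole (s : F.Term V) : labelHoles hole s = .var (.inr s) := rfl

theorem labelHoles_ctxVar (x : V) (s : F.Term V) : labelHoles (ctxVar x) s = .var (.inl x) := rfl

theorem labelHoles_func {n : ℕ} (f : F.Functions n) (Cs : Fin n → Ctx F V)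
    (ts : Fin n → F.Term V) :
    labelHoles (.func f Cs) (.func f ts) = .func f fun i => labelHoles (Cs i) (ts i) := by
  simp only [labelHoles, subtermAt_func_cons, subtermAt_nil, Option.getD_some]

theorem Fits.val_labelHoles (h : Fits M s) : val (labelHoles M s) = s := by
  induction M generalizing s with
  | var x =>
    cases x with
    | none => rfl
    | some x => exact (ctxVar_fits_iff.1 h).symm
  | func f Cs ih =>
    obtain ⟨ts, rfl, hs⟩ := func_fits_iff.1 h
    rw [labelHoles_func]
    exact congrArg (Term.func f) (funext fun i => ih i (hs i))

theorem shape_labelHoles (M : Ctx F V) (s : F.Term V) : shape (labelHoles M s) = M := by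
  induction M generalizing s with
  | var x => cases x <;> rfl
  | func f Cs ih => exact congrArg (Term.func f) (funext fun i => ih i _)

theorem subtermAt_of_labelHoles {E : LTerm F V} (h : subtermAt (labelHoles M s) p = some E) :
    subtermAt M p = some (shape E) := by
  rw [← shape_labelHoles M s]
  exact subtermAt_subst h _

theorem labelHoles_subst (E : F.Term Y) (σ : Y → Ctx F V) (τ : Y → F.Term V) :
    labelHoles (E.subst σ) (E.subst τ) = E.subst fun y => labelHoles (σ y) (τ y) := by
  induction E with
  | var y => rfl
  | func f ts ih => simp only [Term.subst, labelHoles_func, ih]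

theorem subtermAt_labelHoles (hM : subtermAt M p = some C) (hs : subtermAt s p = some a) :
    subtermAt (labelHoles M s) p = some (labelHoles C a) := by
  induction hM using subtermAt_induction generalizing s with
  | nil => rw [subtermAt_nil] at hs ⊢; rw [Option.some.inj hs]
  | cons f Cs i p _ ih =>
    rw [labelHoles, subtermAt_func_cons]
    obtain ⟨n, g, ts, k, rfl, hk, hi⟩ := exists_func_of_subtermAt_cons hs
    rw [hk, subtermAt_func_cons, subtermAt_nil]
    exact ih hi

theorem replaceAt_labelHoles (h : Fits M s) (hM : subtermAt M p = some C) :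
    labelHoles (replaceAt M p K) (replaceAt s p b) =
      replaceAt (labelHoles M s) p (labelHoles K b) := by
  induction hM using subtermAt_induction generalizing s with
  | nil => simp only [replaceAt_nil]
  | cons f Cs i p _ ih =>
    obtain ⟨ts, rfl, hts⟩ := func_fits_iff.1 h
    simp only [replaceAt_func_cons, labelHoles_func, Term.func.injEq, heq_eq_eq, true_and]
    funext k
    rcases eq_or_ne k i with rfl | hk
    · simpa only [Function.update_self] using ih (hts k)
    · simp only [Function.update_of_ne hk]

theorem relSubst_labelHoles {E : F.Term Y} {σ : Y → Ctx F V} {τ : Y → F.Term V}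
    (hK : Below (E.subst σ) K) (hfit : Fits K (E.subst τ)) :
    RelSubst (fun y Z => ∃ C, Z = labelHoles C (τ y) ∧ Below (σ y) C ∧ Fits C (τ y)) E
      (labelHoles K (E.subst τ)) := by
  induction E generalizing K with
  | var y => exact .var ⟨K, rfl, hK, hfit⟩
  | func f Es ih =>
    obtain ⟨Ks, rfl, hKs⟩ := func_below_iff.1 hK
    obtain ⟨ts, hts, hfits⟩ := func_fits_iff.1 hfit
    cases hts
    simp only [Term.subst, labelHoles_func]
    exact .func f fun i => ih i (hKs i) (hfits i)

theorem fits_subst {E : F.Term Y} {σ : Y → Ctx F V} {τ : Y → F.Term V}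
    (h : ∀ y, Fits (σ y) (τ y)) : Fits (E.subst σ) (E.subst τ) := by
  induction E with
  | var y => exact h y
  | func f Es ih => exact func_fits_iff.2 ⟨_, rfl, ih⟩

theorem shape_fits_val (E : LTerm F V) : Fits (shape E) (val E) :=
  fits_subst fun | .inl _ => ctxVar_fits_iff.2 rfl | .inr a => hole_fits a

theorem unlabelled_subst (t : F.Term V) (θ : V ⊕ F.Term V → F.Term Y) :
    (unlabelled t).subst θ = t.subst fun x => θ (.inl x) :=
  subst_subst t _ θ

theorem val_unlabelled (t : F.Term V) : val (unlabelled t) = t :=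
  (unlabelled_subst t _).trans (subst_var t)

theorem inr_notMem_vars_unlabelled {t : F.Term V} : .inr a ∉ vars (unlabelled t) := by
  simp [unlabelled, mem_vars_subst]

end Labels

section LayerSystems

variable {F : FirstOrder.Language.{u, v}} {V : Type w} {𝕃 : Set (Ctx F V)} {C D L N K : Ctx F V}
  {s t a b c : F.Term V} {k : ℕ} {q : List ℕ}

/-- A context up to the difference between variables and holes, which (L2) renders irrelevant for
membership in a layer system. -/
def erase (C : Ctx F V) : Ctx F V := C.subst fun _ => hole

theorem iff_erase_of_forall_replaceAt {P : Ctx F V → Prop}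
    (h : ∀ (x : V) (C : Ctx F V) (p : List ℕ), IsPos C p →
      (P (replaceAt C p (ctxVar x)) ↔ P (replaceAt C p hole))) (C : Ctx F V) :
    P C ↔ P (erase C) := by
  induction C generalizing P with
  | var y =>
    cases y with
    | none => exact Iff.rfl
    | some x =>
      have := h x hole [] ⟨_, subtermAt_nil _⟩
      rwa [replaceAt_nil, replaceAt_nil] at this
  | func f Cs ih =>
    refine update_induction (P := fun Ds => P (.func f Cs) ↔ P (.func f Ds)) Iff.rfl
      fun Ds i hi hDs => hDs.trans ?_
    have := ih i (P := fun D => P (.func f (Function.update Ds i D))) fun x C p ⟨D, hD⟩ => by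
      have := h x (.func f (Function.update Ds i C)) (i :: p) ⟨D, by simpa [subtermAt] using hD⟩
      simpa only [replaceAt_func_cons, Function.update_self, Function.update_idem] using this
    rwa [← hi, Function.update_eq_self, hi] at this

theorem CondL2.mem_iff (h : CondL2 𝕃) (hCD : erase C = erase D) : C ∈ 𝕃 ↔ D ∈ 𝕃 := by
  have herase (C : Ctx F V) : C ∈ 𝕃 ↔ erase C ∈ 𝕃 :=
    iff_erase_of_forall_replaceAt (P := (· ∈ 𝕃)) h C
  rw [herase C, herase D, hCD]

theorem IsLayerSystem.exists_maxTop (h : IsLayerSystem 𝕃) (s : F.Term V) :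
    ∃ M ∈ 𝕃, Fits M s ∧ ∀ N ∈ 𝕃, Fits N s → Below N M := by
  obtain ⟨T, ⟨hT, hTs⟩, hne⟩ := h.condL1 s
  have hfinite : (ctxSize '' {M | M ∈ 𝕃 ∧ Fits M s}).Finite :=
    (Set.finite_Iic (ctxSize (toCtx s))).subset <|
      Set.image_subset_iff.2 fun M hM => Below.ctxSize_le hM.2
  obtain ⟨M, ⟨hM, hMs⟩, hsize⟩ := hfinite.exists_maximalFor' _ _ ⟨T, hT, hTs⟩
  have hmax {N : Ctx F V} (hN : N ∈ 𝕃) (hNs : Fits N s) (hMN : Below M N) : M = N :=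
    hMN.eq_of_ctxSize_le (hsize ⟨hN, hNs⟩ hMN.ctxSize_le)
  refine ⟨M, hM, hMs, fun N hN hNs => ?_⟩
  rcases M with (_ | x) | ⟨f, Ms⟩
  · exact absurd (hmax hT hTs (.hole_below T)).symm hne
  · obtain rfl := ctxVar_fits_iff.1 hMs
    exact hNs
  · -- (L3) at the root: the merge of `M` and `N` is a layer.
    obtain ⟨E, hE, hEs⟩ := exists_isMerge hMs hNs
    have hmem := h.condL3 _ hM N hN [] _ E ⟨_, f, Ms, subtermAt_nil _⟩ (subtermAt_nil _) hE
    rw [replaceAt_nil] at hmem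
    rw [hmax hmem hEs hE.1]
    exact hE.2.1

open Classical in
/-- The max-top of a term with respect to a layer system, as the greatest of its tops. If there is
no greatest top, the value is the hole. -/
noncomputable def maxTop (𝕃 : Set (Ctx F V)) (s : F.Term V) : Ctx F V :=
  if h : ∃ M ∈ 𝕃, Fits M s ∧ ∀ N ∈ 𝕃, Fits N s → Below N M then h.choose else hole

theorem IsLayerSystem.maxTop_spec (h : IsLayerSystem 𝕃) (s : F.Term V) :
    maxTop 𝕃 s ∈ 𝕃 ∧ Fits (maxTop 𝕃 s) s ∧ ∀ N ∈ 𝕃, Fits N s → Below N (maxTop 𝕃 s) := by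
  have hs := h.exists_maxTop s
  rw [maxTop, dif_pos hs]
  exact hs.choose_spec

theorem IsLayerSystem.maxTop_mem (h : IsLayerSystem 𝕃) (s : F.Term V) : maxTop 𝕃 s ∈ 𝕃 :=
  (h.maxTop_spec s).1

theorem IsLayerSystem.maxTop_fits (h : IsLayerSystem 𝕃) (s : F.Term V) : Fits (maxTop 𝕃 s) s :=
  (h.maxTop_spec s).2.1

theorem IsLayerSystem.below_maxTop (h : IsLayerSystem 𝕃) (hN : N ∈ 𝕃) (hNs : Fits N s) :
    Below N (maxTop 𝕃 s) :=
  (h.maxTop_spec s).2.2 N hN hNs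

theorem IsLayerSystem.maxTop_ne_hole (h : IsLayerSystem 𝕃) (s : F.Term V) :
    maxTop 𝕃 s ≠ hole := by
  obtain ⟨T, ⟨hT, hTs⟩, hne⟩ := h.condL1 s
  intro hs
  exact hne ((hs ▸ h.below_maxTop hT hTs).antisymm (.hole_below T))

theorem IsLayerSystem.isMaxTop_iff (h : IsLayerSystem 𝕃) :
    IsMaxTop 𝕃 C (toCtx s) ↔ C = maxTop 𝕃 s := by
  constructor
  · rintro ⟨⟨hC, hCs⟩, hmax⟩
    exact (hmax _ ⟨h.maxTop_mem s, h.maxTop_fits s⟩ (h.below_maxTop hC hCs)).symm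
  · rintro rfl
    exact ⟨⟨h.maxTop_mem s, h.maxTop_fits s⟩,
      fun N hN hMN => (h.below_maxTop hN.1 hN.2).antisymm hMN⟩

/-- The decomposition `s = M[s₁, …, sₙ]` of a term into its max-top `M` and its aliens: the labelled
term with shape `M` whose labels are `s₁, …, sₙ`. -/
noncomputable def aliens (𝕃 : Set (Ctx F V)) (s : F.Term V) : LTerm F V :=
  labelHoles (maxTop 𝕃 s) s

theorem IsLayerSystem.val_aliens (h : IsLayerSystem 𝕃) (s : F.Term V) : val (aliens 𝕃 s) = s :=
  (h.maxTop_fits s).val_labelHoles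

theorem shape_aliens (s : F.Term V) : shape (aliens 𝕃 s) = maxTop 𝕃 s := shape_labelHoles _ _

theorem IsLayerSystem.subtermAt_of_aliens (h : IsLayerSystem 𝕃) {E : LTerm F V}
    (hE : subtermAt (aliens 𝕃 s) q = some E) : subtermAt s q = some (val E) := by
  conv_lhs => rw [← h.val_aliens s]
  exact subtermAt_subst hE _

theorem IsLayerSystem.exists_subtermAt_aliens (h : IsLayerSystem 𝕃)
    (hq : subtermAt (maxTop 𝕃 s) q = some hole) :
    ∃ a, subtermAt (aliens 𝕃 s) q = some (.var (.inr a)) := by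
  obtain ⟨a, ha, -⟩ := (h.maxTop_fits s).exists_subtermAt hq
  exact ⟨a, subtermAt_labelHoles hq ha⟩

theorem IsLayerSystem.weight_lt_of_mem_vars_aliens (h : IsLayerSystem 𝕃) {w : V → ℕ}
    (ha : .inr a ∈ vars (aliens 𝕃 t)) : weight w a < weight w t := by
  have hne : aliens 𝕃 t ≠ .var (.inr a) := fun e =>
    h.maxTop_ne_hole t (by rw [← shape_aliens, e]; rfl)
  have hweight : weight w t = weight (Sum.elim w (weight w)) (aliens 𝕃 t) := by
    conv_lhs => rw [← h.val_aliens t]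
    refine (weight_subst _ _ _).trans (congrArg (weight · _) (funext ?_))
    rintro (x | a) <;> rfl
  cases hE : aliens 𝕃 t with
  | var y =>
    rw [hE, mem_vars_var] at ha
    exact absurd (ha ▸ hE) hne
  | func f Es =>
    rw [hE] at ha hweight
    obtain ⟨i, hi⟩ := mem_vars_func.1 ha
    have hle := le_weight_of_mem_vars (w := Sum.elim w (weight w)) hi
    rw [hweight]
    exact hle.trans_lt (weight_arg_lt f Es i)

/-- The rank of `t` is at most `k`; there are no terms of rank `0`. -/
def RankLE (𝕃 : Set (Ctx F V)) : ℕ → F.Term V → Prop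
  | 0, _ => False
  | k + 1, t => ∀ a, .inr a ∈ vars (aliens 𝕃 t) → RankLE 𝕃 k a

theorem RankLE.succ (h : RankLE 𝕃 k t) : RankLE 𝕃 (k + 1) t := by
  induction k generalizing t with
  | zero => exact h.elim
  | succ k ih => exact fun a ha => ih (h a ha)

/-- The rank of `c` is less than the rank of `b`, expressed through the bounds on these ranks. -/
def RankLT (𝕃 : Set (Ctx F V)) (c b : F.Term V) : Prop := ∀ k, RankLE 𝕃 (k + 1) b → RankLE 𝕃 k c

theorem IsLayerSystem.exists_rankLE (h : IsLayerSystem 𝕃) (t : F.Term V) :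
    ∃ k, RankLE 𝕃 k t := by
  suffices H : ∀ k (t : F.Term V), weight (fun _ => 1) t < k → RankLE 𝕃 k t from
    ⟨_, H _ t (Nat.lt_succ_self _)⟩
  intro k
  induction k with
  | zero => exact fun t ht => absurd ht (Nat.not_lt_zero _)
  | succ k ih =>
    exact fun t ht a ha =>
      ih a ((h.weight_lt_of_mem_vars_aliens ha).trans_le (Nat.lt_succ_iff.1 ht))

theorem IsLayerSystem.hasRank_one (h : IsLayerSystem 𝕃) (ht : RankLE 𝕃 1 t) : HasRank 𝕃 t 1 := by
  have hno (p : List ℕ) : subtermAt (maxTop 𝕃 t) p ≠ some hole := fun hp => by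
    obtain ⟨a, ha⟩ := h.exists_subtermAt_aliens hp
    exact ht a (vars_subset_of_subtermAt ha (mem_vars_var.2 rfl))
  exact .intro (k := fun _ => 0) (m := 0) (h.isMaxTop_iff.2 rfl) (fun p a hp => (hno p hp).elim)
    (fun _ _ => le_rfl) (Or.inl rfl)

theorem IsLayerSystem.maxTop_below_of_subtermAt (h : IsLayerSystem 𝕃)
    (hK : subtermAt (maxTop 𝕃 t) q = some K) (hb : subtermAt t q = some b) (hne : K ≠ hole) :
    Below (maxTop 𝕃 b) K := by
  obtain ⟨b', hb', hKb⟩ := (h.maxTop_fits t).exists_subtermAt hK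
  obtain rfl : b' = b := Option.some.inj (hb'.symm.trans hb)
  rcases K with (_ | x) | ⟨f, Ks⟩
  · exact absurd rfl hne
  · obtain rfl := ctxVar_fits_iff.1 hKb
    exact h.maxTop_fits _
  · obtain ⟨E, hE, hEb⟩ := exists_isMerge hKb (h.maxTop_fits b')
    have hmem : replaceAt (maxTop 𝕃 t) q E ∈ 𝕃 :=
      h.condL3 _ (h.maxTop_mem t) _ (h.maxTop_mem b') q _ E ⟨_, f, Ks, hK⟩ hK hE
    have hfit : Fits (replaceAt (maxTop 𝕃 t) q E) t :=
      (h.maxTop_fits t).replaceAt_left hK hb hEb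
    obtain ⟨K', hK', hEK⟩ :=
      (h.below_maxTop hmem hfit).exists_subtermAt (subtermAt_replaceAt hK E)
    rw [Option.some.inj (hK.symm.trans hK')]
    exact hE.2.1.trans hEK

theorem IsLayerSystem.rankLT_of_mem_vars_labelHoles (h : IsLayerSystem 𝕃)
    (hK : subtermAt (maxTop 𝕃 t) q = some K) (hb : subtermAt t q = some b) (hne : K ≠ hole)
    (hc : .inr c ∈ vars (labelHoles K b)) : RankLT 𝕃 c b := by
  intro k hrank
  induction k using Nat.strong_induction_on generalizing q b K with | _ k ih
  obtain ⟨b', hb', hKb⟩ := (h.maxTop_fits t).exists_subtermAt hK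
  obtain rfl : b' = b := Option.some.inj (hb'.symm.trans hb)
  have hbelow : Below (shape (aliens 𝕃 b')) K := by
    rw [shape_aliens]
    exact h.maxTop_below_of_subtermAt hK hb hne
  have hrel := relSubst_labelHoles hbelow (τ := Sum.elim .var id)
    (show Fits K (val (aliens 𝕃 b')) by rwa [h.val_aliens])
  rw [show (aliens 𝕃 b').subst _ = b' from h.val_aliens b'] at hrel
  obtain ⟨q', y, _, hy, hw, ⟨K', rfl, hyK', -⟩, hc⟩ := hrel.exists_subtermAt_of_mem_vars hc
  rcases y with x | a
  · obtain rfl := ctxVar_below_iff.1 hyK'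
    simp [labelHoles_ctxVar] at hc
  have ha : RankLE 𝕃 k a := hrank a (vars_subset_of_subtermAt hy (mem_vars_var.2 rfl))
  by_cases hK' : K' = hole
  · rw [hK', labelHoles_hole, mem_vars_var, Sum.inr.injEq] at hc
    exact hc ▸ ha
  · cases k with
    | zero => exact ha.elim
    | succ k =>
      have hK'q := subtermAt_of_labelHoles hw
      rw [shape_labelHoles] at hK'q
      refine (ih k (Nat.lt_succ_self k) (q := q ++ q') ?_ ?_ hK' hc ha).succ
      · rwa [subtermAt_append, hK]
      · rw [subtermAt_append, hb]
        exact h.subtermAt_of_aliens hy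

theorem IsLayerSystem.eq_hole_of_fits_alien (h : IsLayerSystem 𝕃) (hC2 : CondC2 𝕃)
    (hLs : erase L = erase (maxTop 𝕃 s)) (hN : N ∈ 𝕃) (hLN : Below L N)
    (hLq : subtermAt L q = some hole) (hNq : subtermAt N q = some K)
    (ha : subtermAt (aliens 𝕃 s) q = some (.var (.inr a))) (hKa : Fits K a) : K = hole := by
  have hMq : subtermAt (maxTop 𝕃 s) q = some hole := subtermAt_of_labelHoles ha
  have hLK : replaceAt L q K ∈ 𝕃 :=
    hC2 L ((h.condL2.mem_iff hLs).2 (h.maxTop_mem s)) N hN hLN q K hLq hNq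
  have hMK : replaceAt (maxTop 𝕃 s) q K ∈ 𝕃 := by
    refine (h.condL2.mem_iff ?_).1 hLK
    unfold erase at hLs ⊢
    rw [replaceAt_subst hLq, replaceAt_subst hMq, hLs]
  have hfit := (h.maxTop_fits s).replaceAt_left hMq (h.subtermAt_of_aliens ha) hKa
  obtain ⟨K', hK', hKK'⟩ :=
    (h.below_maxTop hMK hfit).exists_subtermAt (subtermAt_replaceAt hMq K)
  obtain rfl : hole = K' := Option.some.inj (hMq.symm.trans hK')
  exact hKK'.antisymm (.hole_below K)

end LayerSystems

section Relabelling

variable {F : FirstOrder.Language.{u, v}} {V : Type w} {𝕃 : Set (Ctx F V)}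
  {r r' q : F.Term V → F.Term V → Prop} {P : F.Term V → Prop} {D E Z : LTerm F V} {s b c : F.Term V}
  {k : ℕ}

/-- `RelLabels r D E` means that `E` arises from the labelled term `D` by replacing each occurrence
of a label `a` by a labelled term that is related to `a` by `r`. -/
def RelLabels (r : F.Term V → LTerm F V → Prop) : LTerm F V → LTerm F V → Prop :=
  RelSubst (Sum.elim (fun x Z => Z = .var (.inl x)) r)

/-- `Relabels r D E` means that `E` arises from the labelled term `D` by replacing each occurrence
of a label by a label to which it is related by `r`. -/
def Relabels (r : F.Term V → F.Term V → Prop) : LTerm F V → LTerm F V → Prop :=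
  RelLabels fun a Z => ∃ b, Z = .var (.inr b) ∧ r a b

theorem relabels_subst {φ : F.Term V → F.Term V} (h : ∀ a, .inr a ∈ vars E → r a (φ a)) :
    Relabels r E (E.subst (Sum.elim (fun x => .var (.inl x)) fun a => .var (.inr (φ a)))) := by
  conv => arg 2; rw [← subst_var E]
  refine (isCompatible_relSubst _).subst ?_
  rintro (x | a) ha
  · exact .var rfl
  · exact .var ⟨φ a, rfl, h a ha⟩

theorem relabels_self (h : ∀ a, .inr a ∈ vars E → r a a) : Relabels r E E := by
  have := relabels_subst h
  rwa [show (Sum.elim _ _ : V ⊕ F.Term V → LTerm F V) = .var from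
    funext fun | .inl _ => rfl | .inr _ => rfl, subst_var] at this

theorem Relabels.shape_eq (h : Relabels r D E) : shape D = shape E := by
  refine RelSubst.subst h isCompatible_eq ?_
  rintro (x | a) Z hZ
  · obtain rfl := hZ
    rfl
  · obtain ⟨b, rfl, -⟩ := hZ
    rfl

theorem Relabels.imp (h : Relabels r D E)
    (hr : ∀ a b, .inr a ∈ vars D → .inr b ∈ vars E → r a b → r' a b) : Relabels r' D E := by
  refine RelSubst.imp_vars h ?_
  rintro (x | a) ha W hW hrW
  · exact hrW
  · obtain ⟨b, rfl, hab⟩ := hrW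
    exact ⟨b, rfl, hr a b ha (hW (mem_vars_var.2 rfl)) hab⟩

theorem Relabels.subst_eq {φ : F.Term V → F.Term V} (h : Relabels (fun a b => φ a = φ b) D E) :
    D.subst (Sum.elim .var φ) = E.subst (Sum.elim .var φ) := by
  refine RelSubst.subst h isCompatible_eq ?_
  rintro (x | a) W hW
  · obtain rfl := hW
    rfl
  · obtain ⟨b, rfl, hab⟩ := hW
    exact hab

theorem Relabels.comp {E' : LTerm F V} (h : Relabels r D E) (h' : Relabels r' D E')
    (hr : ∀ a b c, .inr a ∈ vars D → r a b → r' a c → q b c) : Relabels q E E' := by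
  induction D generalizing E E' with
  | var y =>
    have hE := relSubst_var_iff.1 h
    have hE' := relSubst_var_iff.1 h'
    rcases y with x | a
    · obtain rfl := hE
      obtain rfl := hE'
      exact relSubst_var_iff.2 rfl
    · obtain ⟨b, rfl, hab⟩ := hE
      obtain ⟨c, rfl, hac⟩ := hE'
      exact relSubst_var_iff.2 ⟨c, rfl, hr a b c (mem_vars_var.2 rfl) hab hac⟩
  | func f Ds ih =>
    obtain ⟨Es, rfl, hEs⟩ := relSubst_func_iff.1 h
    obtain ⟨Es', rfl, hEs'⟩ := relSubst_func_iff.1 h'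
    exact .func f fun i => ih i (hEs i) (hEs' i) fun a b c ha =>
      hr a b c (mem_vars_func.2 ⟨i, ha⟩)

theorem relabels_replaceAt {a : F.Term V} {p : List ℕ} (hr : ∀ c, r c c)
    (ha : subtermAt E p = some (.var (.inr a))) (hab : r a b) :
    Relabels r E (replaceAt E p (.var (.inr b))) := by
  have hE : Relabels r E E := relabels_self fun c _ => hr c
  have hlabel : Relabels r (.var (.inr a)) (.var (.inr b)) := relSubst_var_iff.2 ⟨b, rfl, hab⟩
  have := RelSubst.replaceAt hE (K := .var (.inr a)) ha hlabel
  rwa [replaceAt_self ha] at this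

/-- `Retagged P D E` means that `E` arises from the labelled term `D` by replacing some of the
occurrences of labels by labels that satisfy `P`. -/
abbrev Retagged (P : F.Term V → Prop) : LTerm F V → LTerm F V → Prop :=
  Relabels fun a b => a = b ∨ P b

theorem Retagged.of_mem_vars (h : Retagged P D E) (hD : ∀ a, .inr a ∈ vars D → P a)
    (hb : .inr b ∈ vars E) : P b := by
  obtain ⟨p, y, W, hy, -, hW, hb⟩ := RelSubst.exists_subtermAt_of_mem_vars h hb
  rcases y with x | a
  · obtain rfl := hW
    simp at hb
  · obtain ⟨_, rfl, hab⟩ := hW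
    rw [mem_vars_var, Sum.inr.injEq] at hb
    subst hb
    exact hab.elim (fun e => e ▸ hD a (vars_subset_of_subtermAt hy (mem_vars_var.2 rfl))) id

theorem retagged_replaceAt {a : F.Term V} {p : List ℕ} (ha : subtermAt E p = some (.var (.inr a)))
    (hb : P b) : Retagged P E (replaceAt E p (.var (.inr b))) :=
  relabels_replaceAt (fun _ => Or.inl rfl) ha (Or.inr hb)

/-- `Expanded 𝕃 P E Z` means that `Z` arises from the labelled term `E` by making some labels that
satisfy `P` partly visible, where only labels of smaller rank remain inside the label. -/
def Expanded (𝕃 : Set (Ctx F V)) (P : F.Term V → Prop) : LTerm F V → LTerm F V → Prop :=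
  RelLabels fun b Z =>
    Z = .var (.inr b) ∨ P b ∧ val Z = b ∧ ∀ c, .inr c ∈ vars Z → RankLT 𝕃 c b

/-- Unchanged labels of `E` are aliens of `s` and are not expanded by `eq_hole_of_fits_alien`. -/
theorem IsLayerSystem.expanded_aliens (h : IsLayerSystem 𝕃) (hC2 : CondC2 𝕃)
    (hE : Retagged P (aliens 𝕃 s) E) : Expanded 𝕃 P E (aliens 𝕃 (val E)) := by
  have hshape : shape E = maxTop 𝕃 s := hE.shape_eq.symm.trans (shape_aliens s)
  have hbelow : Below (shape E) (maxTop 𝕃 (val E)) :=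
    h.below_maxTop (hshape ▸ h.maxTop_mem s) (shape_fits_val E)
  refine (relSubst_labelHoles hbelow (h.maxTop_fits (val E))).imp_subtermAt ?_
  rintro q (x | b) _ hEq hZ ⟨K, rfl, hK, hKb⟩
  · rw [ctxVar_below_iff.1 hK]
    rfl
  have hNq : subtermAt (maxTop 𝕃 (val E)) q = some K := by
    simpa only [shape_labelHoles] using subtermAt_of_labelHoles hZ
  by_cases hKhole : K = hole
  · exact Or.inl (by rw [hKhole]; rfl)
  have hMq : subtermAt (maxTop 𝕃 s) q = some hole := hshape ▸ subtermAt_subst hEq _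
  obtain ⟨a, ha⟩ := h.exists_subtermAt_aliens hMq
  obtain ⟨_, hEq', hab⟩ := RelSubst.exists_subtermAt hE ha
  obtain ⟨b', hb', hab⟩ := relSubst_var_iff.1 hab
  rw [hb', hEq, Option.some_inj] at hEq'
  cases hEq'
  have hne : a ≠ b := by
    rintro rfl
    exact hKhole (h.eq_hole_of_fits_alien hC2 rfl (h.maxTop_mem _) (hshape ▸ hbelow) hMq hNq ha hKb)
  exact Or.inr ⟨hab.resolve_left hne, hKb.val_labelHoles,
    fun c => h.rankLT_of_mem_vars_labelHoles hNq (subtermAt_subst hEq _) hKhole⟩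

theorem Expanded.mem_vars_or_rankLE (h : Expanded 𝕃 P E Z) (hP : ∀ b, P b → RankLE 𝕃 (k + 1) b)
    (hc : .inr c ∈ vars Z) : .inr c ∈ vars E ∨ RankLE 𝕃 k c := by
  obtain ⟨q, y, W, hy, -, hyW, hc⟩ := RelSubst.exists_subtermAt_of_mem_vars h hc
  rcases y with x | b
  · obtain rfl : W = .var (.inl x) := hyW
    simp at hc
  · rcases hyW with rfl | ⟨hb, -, hW⟩
    · exact Or.inl (vars_subset_of_subtermAt hy hc)
    · exact Or.inr (hW c hc k (hP b hb))

end Relabelling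

section Layered

variable {F : FirstOrder.Language.{u, v}} {V : Type w} {𝕃 : Set (Ctx F V)} {R : TRS F V}
  {M : Ctx F V} {ρ : Rule F V} {s t : F.Term V} {p q : List ℕ} {k : ℕ}

theorem Fits.isFunPos_or (h : Fits M s) (hp : IsFunPos s p) :
    IsFunPos M p ∨ ∃ q p', p = q ++ p' ∧ subtermAt M q = some hole := by
  have ⟨_, f, ts, hs⟩ := hp
  rcases (fits_iff_relSubst.1 h).isFunPos_or ⟨_, hs⟩ with hM | ⟨q, p', _ | x, rfl, hq⟩
  · exact Or.inl hM
  · exact Or.inr ⟨q, p', rfl, hq⟩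
  · obtain ⟨b, hb, hx⟩ := h.exists_subtermAt hq
    obtain rfl := ctxVar_fits_iff.1 hx
    rw [subtermAt_append, hb] at hs
    exact (not_isFunPos_var x p' ⟨_, f, ts, hs⟩).elim

theorem IsLayered.stepAt_aliens (h : IsLayered 𝕃 R) (hρ : ρ ∈ R) (hst : StepAt ρ p s t)
    (hp : IsFunPos (maxTop 𝕃 s) p) :
    ∃ D, StepAt ρ p (aliens 𝕃 s) D ∧ val D = t ∧ (D = aliens 𝕃 t ∨ D = .var (.inr t)) := by
  have hL := h.isLayerSystem
  have hM := hL.isMaxTop_iff.2 (rfl : maxTop 𝕃 s = _)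
  obtain ⟨L, hL', hML⟩ := h.condW ρ hρ s t _ p hM hp hst
  have hD : labelHoles L t = aliens 𝕃 t ∨ labelHoles L t = .var (.inr t) := by
    rcases h.condC1 ρ hρ s t _ p hM hp hst L hL' hML with hLt | rfl
    · exact Or.inl (by rw [hL.isMaxTop_iff.1 hLt]; rfl)
    · exact Or.inr rfl
  refine ⟨labelHoles L t, ?_, ?_, hD⟩
  · obtain ⟨σ, hs, rfl⟩ := hst
    obtain ⟨τ, hM, rfl⟩ := hML
    refine ⟨fun x => labelHoles (τ x) (σ x), ?_, ?_⟩
    · rw [aliens, subtermAt_labelHoles hM hs, labelHoles_subst]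
    · rw [aliens, replaceAt_labelHoles (hL.maxTop_fits s) hM, labelHoles_subst]
  · rcases hD with hD | hD <;> rw [hD]
    · exact hL.val_aliens t
    · rfl

theorem IsLayerSystem.exists_stepAt_alien (h : IsLayerSystem 𝕃) (hst : StepAt ρ (q ++ p) s t)
    (hq : subtermAt (maxTop 𝕃 s) q = some hole) :
    ∃ a b, subtermAt (aliens 𝕃 s) q = some (.var (.inr a)) ∧ StepAt ρ p a b ∧
      t = val (replaceAt (aliens 𝕃 s) q (.var (.inr b))) := by
  obtain ⟨a, ha⟩ := h.exists_subtermAt_aliens hq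
  obtain ⟨b, hab, rfl⟩ := hst.of_append (h.subtermAt_of_aliens ha)
  refine ⟨a, b, ha, hab, ?_⟩
  rw [val, replaceAt_subst ha, show (aliens 𝕃 s).subst _ = s from h.val_aliens s]
  rfl

theorem IsLayered.rankLE_of_rewrites (h : IsLayered 𝕃 R) (hs : RankLE 𝕃 k s)
    (hst : Rewrites R s t) : RankLE 𝕃 k t := by
  have hL := h.isLayerSystem
  induction k generalizing s t with
  | zero => exact hs.elim
  | succ k ih =>
    obtain ⟨ρ, hρ, p, hst⟩ := hst
    rcases (hL.maxTop_fits s).isFunPos_or hst.isFunPos with hp | ⟨q, p', rfl, hq⟩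
    · obtain ⟨D, hD, rfl, ht | ht⟩ := h.stepAt_aliens hρ hst hp
      · exact fun a ha => hs a (hD.vars_subset (ht ▸ ha))
      · exact (hs _ (hD.vars_subset (ht ▸ mem_vars_var.2 rfl))).succ
    · obtain ⟨a, b, ha, hab, rfl⟩ := hL.exists_stepAt_alien hst hq
      have haRank := hs a (vars_subset_of_subtermAt ha (mem_vars_var.2 rfl))
      have hbRank : RankLE 𝕃 k b := ih haRank ⟨ρ, hρ, p', hab⟩
      have hE := hL.expanded_aliens h.condC2 (retagged_replaceAt (P := RankLE 𝕃 k) ha hbRank)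
      intro c hc
      rcases hE.mem_vars_or_rankLE (fun _ hb => hb.succ) hc with hc | hc
      · rcases vars_replaceAt_subset ha _ hc with hc | hc
        · exact hs c hc
        · rw [mem_vars_var, Sum.inr.injEq] at hc
          exact hc ▸ hbRank
      · exact hc

theorem IsLayered.rankLE_of_reduces (h : IsLayered 𝕃 R) (hs : RankLE 𝕃 k s)
    (hst : Reduces R s t) : RankLE 𝕃 k t := by
  induction hst with
  | refl => exact hs
  | tail _ hst ih => exact h.rankLE_of_rewrites ih hst

end Layered

section Base

variable {F : FirstOrder.Language.{u, v}} {V : Type w} {𝕃 : Set (Ctx F V)} {R : TRS F V}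
  {P : F.Term V → Prop} {E Z D : LTerm F V} {s a c : F.Term V} {m k : ℕ}

open Classical in
/-- The labelled term `E` with its labels of rank at most `m` unfolded, so that exactly its tall
labels, those of rank greater than `m`, remain. -/
noncomputable def unfoldLabels (𝕃 : Set (Ctx F V)) (m : ℕ) (E : LTerm F V) : LTerm F V :=
  E.subst (Sum.elim (fun x => .var (.inl x))
    fun a => if RankLE 𝕃 m a then unlabelled a else .var (.inr a))

theorem unfoldLabels_inr_of_rankLE (h : RankLE 𝕃 m a) :
    unfoldLabels 𝕃 m (.var (.inr a)) = unlabelled a :=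
  if_pos h

theorem unfoldLabels_inr_of_not_rankLE (h : ¬ RankLE 𝕃 m a) :
    unfoldLabels 𝕃 m (.var (.inr a)) = .var (.inr a) :=
  if_neg h

theorem val_unfoldLabels (E : LTerm F V) : val (unfoldLabels 𝕃 m E) = val E := by
  rw [val, unfoldLabels, subst_subst]
  refine subst_congr ?_
  rintro (x | a) -
  · rfl
  by_cases ha : RankLE 𝕃 m a
  · rw [Sum.elim_inr, if_pos ha]
    exact val_unlabelled a
  · simp only [Sum.elim_inr, if_neg ha, Term.subst]

theorem mem_vars_of_unfoldLabels (h : .inr c ∈ vars (unfoldLabels 𝕃 m E)) :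
    .inr c ∈ vars E ∧ ¬ RankLE 𝕃 m c := by
  obtain ⟨x | a, ha, hc⟩ := mem_vars_subst.1 h
  · simp at hc
  by_cases hrank : RankLE 𝕃 m a
  · rw [Sum.elim_inr, if_pos hrank] at hc
    exact (inr_notMem_vars_unlabelled hc).elim
  · rw [Sum.elim_inr, if_neg hrank, mem_vars_var, Sum.inr.injEq] at hc
    exact hc ▸ ⟨ha, hrank⟩

theorem unfoldLabels_eq_unlabelled (h : ∀ a, .inr a ∈ vars E → RankLE 𝕃 m a) :
    unfoldLabels 𝕃 m E = unlabelled (val E) := by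
  rw [unfoldLabels, unlabelled, val, subst_subst]
  refine subst_congr ?_
  rintro (x | a) ha
  · rfl
  · exact if_pos (h a ha)

theorem Expanded.unfoldLabels_eq (h : Expanded 𝕃 P E Z) (hP : ∀ b, P b → RankLE 𝕃 m b) :
    unfoldLabels 𝕃 m E = unfoldLabels 𝕃 m Z := by
  refine RelSubst.subst h isCompatible_eq ?_
  rintro (x | b) W hW
  · obtain rfl := hW
    rfl
  · rcases hW with rfl | ⟨hb, hval, hlt⟩
    · rfl
    · exact (unfoldLabels_inr_of_rankLE (hP b hb)).trans
        ((unfoldLabels_eq_unlabelled fun c hc => hlt c hc m (hP b hb).succ).trans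
          (by rw [hval])).symm

/-- The base of `s`: its tall aliens, those of rank greater than `m`, are hidden. -/
noncomputable def base (𝕃 : Set (Ctx F V)) (m : ℕ) (s : F.Term V) : LTerm F V :=
  unfoldLabels 𝕃 m (aliens 𝕃 s)

theorem IsLayerSystem.val_base (h : IsLayerSystem 𝕃) (s : F.Term V) : val (base 𝕃 m s) = s :=
  (val_unfoldLabels _).trans (h.val_aliens s)

theorem IsLayerSystem.base_eq_unlabelled (h : IsLayerSystem 𝕃) (hs : RankLE 𝕃 (m + 1) s) :
    base 𝕃 m s = unlabelled s := by
  rw [base, unfoldLabels_eq_unlabelled hs, h.val_aliens]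

theorem rankLE_of_mem_vars_base (hs : RankLE 𝕃 (k + 1) s) (ha : .inr a ∈ vars (base 𝕃 m s)) :
    RankLE 𝕃 k a :=
  hs a (mem_vars_of_unfoldLabels ha).1

theorem IsLayerSystem.rewrites_val_of_base (h : IsLayerSystem 𝕃)
    (hD : Rewrites R (base 𝕃 m s) D) : Rewrites R s (val D) := by
  have := hD.subst (Sum.elim .var id)
  rwa [show (base 𝕃 m s).subst _ = s from h.val_base s] at this

open Classical in
theorem base_subst_eq (s : F.Term V) (g : F.Term V → V) :
    (base 𝕃 m s).subst (Sum.elim .var fun a => .var (g a)) =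
      (aliens 𝕃 s).subst (Sum.elim .var fun a => if RankLE 𝕃 m a then a else .var (g a)) := by
  rw [base, unfoldLabels, subst_subst]
  refine subst_congr ?_
  rintro (x | a) -
  · rfl
  by_cases ha : RankLE 𝕃 m a
  · rw [Sum.elim_inr, Sum.elim_inr, if_pos ha, if_pos ha, unlabelled_subst]
    exact subst_var a
  · simp only [Sum.elim_inr, if_neg ha, Term.subst]

/-- The replaced aliens become visible variables, which does not change the layer up to (L2). The
remaining aliens are still aliens afterwards, by `eq_hole_of_fits_alien`. -/
theorem IsLayerSystem.rankLE_base_subst (h : IsLayerSystem 𝕃) (hC2 : CondC2 𝕃) (s : F.Term V)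
    (g : F.Term V → V) :
    RankLE 𝕃 (m + 1) ((base 𝕃 m s).subst (Sum.elim .var fun a => .var (g a))) := by
  classical
  rw [base_subst_eq]
  let σ : V ⊕ F.Term V → Ctx F V :=
    Sum.elim ctxVar fun a => if RankLE 𝕃 m a then hole else ctxVar (g a)
  let τ : V ⊕ F.Term V → F.Term V :=
    Sum.elim .var fun a => if RankLE 𝕃 m a then a else .var (g a)
  have herase : erase ((aliens 𝕃 s).subst σ) = erase (maxTop 𝕃 s) := by
    rw [← shape_aliens, erase, erase, shape, subst_subst, subst_subst]
    refine subst_congr ?_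
    rintro (x | a) -
    · rfl
    · by_cases ha : RankLE 𝕃 m a <;> simp [σ, ha, hole, ctxVar]
  have hfits : Fits ((aliens 𝕃 s).subst σ) ((aliens 𝕃 s).subst τ) := fits_subst <| by
    rintro (x | a)
    · exact ctxVar_fits_iff.2 rfl
    · by_cases ha : RankLE 𝕃 m a
      · simpa [σ, τ, ha] using hole_fits a
      · simp [σ, τ, ha, ctxVar_fits_iff]
  have hbelow := h.below_maxTop ((h.condL2.mem_iff herase).2 (h.maxTop_mem s)) hfits
  intro c hc
  obtain ⟨q, y, _, hy, hW, ⟨K, rfl, hK, hKy⟩, hc⟩ :=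
    (relSubst_labelHoles hbelow (h.maxTop_fits _)).exists_subtermAt_of_mem_vars hc
  by_cases hshort : ∃ a, y = .inr a ∧ RankLE 𝕃 m a
  · obtain ⟨a, rfl, ha⟩ := hshort
    have hLq := subtermAt_subst hy σ
    simp only [Term.subst, σ, τ, Sum.elim_inr, if_pos ha] at hLq hKy hc
    obtain rfl := h.eq_hole_of_fits_alien hC2 herase (h.maxTop_mem _) hbelow hLq
      (by simpa only [shape_labelHoles] using subtermAt_of_labelHoles hW) hy hKy
    rw [labelHoles_hole, mem_vars_var, Sum.inr.injEq] at hc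
    rwa [hc]
  · obtain ⟨x, hx⟩ : ∃ x, σ y = ctxVar x := by
      rcases y with x | a
      · exact ⟨x, rfl⟩
      · exact ⟨g a, if_neg fun ha => hshort ⟨a, rfl, ha⟩⟩
    rw [hx, ctxVar_below_iff] at hK
    rw [hK, labelHoles_ctxVar, mem_vars_var] at hc
    cases hc

theorem confluentAt_of_subst_injOn {X Y : Type*} {t : F.Term X} {g : X → Y}
    (hg : Set.InjOn g (vars t)) (h : ConfluentAt (Rewrites R) (t.subst fun x => .var (g x))) :
    ConfluentAt (Rewrites R) t := by
  let ζ : Y → F.Term X :=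
    Function.extend ((vars t).domRestrict g) (fun x => .var x) fun _ => t
  have hζ {u : F.Term X} (hu : vars u ⊆ vars t) :
      (u.subst fun x => .var (g x)).subst ζ = u := by
    rw [subst_subst]
    refine (subst_congr fun x hx => ?_).trans (subst_var u)
    exact hg.injective.extend_apply (fun x => .var x) (fun _ => t) ⟨x, hu hx⟩
  intro b c hb hc
  obtain ⟨d, hbd, hcd⟩ := h _ _ (Reduces.subst hb _) (Reduces.subst hc _)
  refine ⟨d.subst ζ, ?_, ?_⟩
  · simpa only [hζ (Reduces.vars_subset hb)] using Reduces.subst hbd ζ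
  · simpa only [hζ (Reduces.vars_subset hc)] using Reduces.subst hcd ζ

theorem exists_injOn_sumElim {α β : Type*} [Infinite β] {B : Set (β ⊕ α)} (hB : B.Finite) :
    ∃ g : α → β, Set.InjOn (Sum.elim id g) B := by
  obtain ⟨f, hf⟩ := Set.countable_iff_exists_injOn.1
    (hB.preimage (f := Sum.inr) Sum.inr_injective.injOn).countable
  have hW := hB.preimage (f := Sum.inl) Sum.inl_injective.injOn
  let e := hW.infinite_compl.natEmbedding
  have hne {x a} (hx : Sum.inl x ∈ B) : x ≠ e (f a) := fun hxa => (e (f a)).2 (hxa ▸ hx)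
  refine ⟨fun a => e (f a), ?_⟩
  rintro (x | a) hx (y | b) hy hxy
  · exact congrArg Sum.inl hxy
  · exact (hne hx hxy).elim
  · exact (hne hy hxy.symm).elim
  · exact congrArg Sum.inr (hf hx hy (e.injective (Subtype.ext hxy)))

theorem IsLayerSystem.confluentAt_base [Infinite V] (h : IsLayerSystem 𝕃) (hC2 : CondC2 𝕃)
    (hconf : ∀ t, RankLE 𝕃 (m + 1) t → ConfluentAt (Rewrites R) t) (s : F.Term V) :
    ConfluentAt (Rewrites R) (base 𝕃 m s) := by
  obtain ⟨g, hg⟩ := exists_injOn_sumElim (finite_vars (base 𝕃 m s))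
  refine confluentAt_of_subst_injOn hg ?_
  convert hconf _ (h.rankLE_base_subst hC2 s g) using 2
  funext y
  cases y <;> rfl

end Base

section BaseSteps

variable {F : FirstOrder.Language.{u, v}} {V : Type w} {𝕃 : Set (Ctx F V)} {R : TRS F V}
  {ρ : Rule F V} {s t t₁ t₂ : F.Term V} {D : LTerm F V} {p : List ℕ} {m k : ℕ}

theorem IsLayered.stepAt_base (h : IsLayered 𝕃 R) (hρ : ρ ∈ R) (hst : StepAt ρ p s t)
    (hp : IsFunPos (base 𝕃 m s) p) :
    ∃ D, StepAt ρ p (base 𝕃 m s) D ∧ val D = t ∧ (D = base 𝕃 m t ∨ D = .var (.inr t)) := by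
  have hL := h.isLayerSystem
  rcases (hL.maxTop_fits s).isFunPos_or hst.isFunPos with hpM | ⟨q, p, rfl, hq⟩
  · obtain ⟨D, hD, hval, hDt⟩ := h.stepAt_aliens hρ hst hpM
    refine ⟨unfoldLabels 𝕃 m D, hD.subst _, (val_unfoldLabels D).trans hval, ?_⟩
    rcases hDt with rfl | rfl
    · exact Or.inl rfl
    by_cases ht : RankLE 𝕃 m t
    · exact Or.inl (by rw [unfoldLabels_inr_of_rankLE ht, hL.base_eq_unlabelled ht.succ])
    · exact Or.inr (unfoldLabels_inr_of_not_rankLE ht)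
  · obtain ⟨a, b, ha, hab, rfl⟩ := hL.exists_stepAt_alien hst hq
    have hbase : subtermAt (base 𝕃 m s) q = some (unfoldLabels 𝕃 m (.var (.inr a))) :=
      subtermAt_subst ha _
    have haRank : RankLE 𝕃 m a := by
      by_contra hna
      obtain ⟨n, f, ts, hp⟩ := hp
      rw [subtermAt_append, hbase, unfoldLabels_inr_of_not_rankLE hna] at hp
      exact not_isFunPos_var _ p ⟨n, f, ts, hp⟩
    have hbRank : RankLE 𝕃 m b := h.rankLE_of_rewrites haRank ⟨ρ, hρ, p, hab⟩
    have hE := hL.expanded_aliens h.condC2 (retagged_replaceAt (P := RankLE 𝕃 m) ha hbRank)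
    have hD : replaceAt (base 𝕃 m s) q (unlabelled b) =
        base 𝕃 m (val (replaceAt (aliens 𝕃 s) q (.var (.inr b)))) := by
      rw [base, base, ← hE.unfoldLabels_eq fun _ => id, ← unfoldLabels_inr_of_rankLE hbRank]
      exact (replaceAt_subst ha _ _).symm
    rw [unfoldLabels_inr_of_rankLE haRank] at hbase
    exact ⟨_, (hab.subst _).append hbase, (congrArg val hD).trans (hL.val_base _), Or.inl hD⟩

theorem IsLayered.eq_base_or_eq_var (h : IsLayered 𝕃 R) (hD : Rewrites R (base 𝕃 m s) D) :
    D = base 𝕃 m (val D) ∨ D = .var (.inr (val D)) := by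
  obtain ⟨ρ, hρ, p, hD⟩ := hD
  have hst : StepAt ρ p s (val D) := by
    have := hD.subst (Sum.elim .var id)
    rwa [show (base 𝕃 m s).subst _ = s from h.isLayerSystem.val_base s] at this
  obtain ⟨D', hD', -, hD't⟩ := h.stepAt_base hρ hst hD.isFunPos
  rwa [hD'.unique hD] at hD't

/-- A rewrite step that takes place in the base of a term. -/
def BaseStep (𝕃 : Set (Ctx F V)) (R : TRS F V) (m : ℕ) (s t : F.Term V) : Prop :=
  ∃ D, Rewrites R (base 𝕃 m s) D ∧ val D = t

/-- Reduction in any number of base steps. -/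
abbrev BaseReduces (𝕃 : Set (Ctx F V)) (R : TRS F V) (m : ℕ) : F.Term V → F.Term V → Prop :=
  Relation.ReflTransGen (BaseStep 𝕃 R m)

theorem IsLayerSystem.reduces_of_baseReduces (h : IsLayerSystem 𝕃)
    (hst : BaseReduces 𝕃 R m s t) : Reduces R s t := by
  induction hst with
  | refl => exact .refl
  | tail _ hst ih =>
    obtain ⟨D, hD, rfl⟩ := hst
    exact ih.tail (h.rewrites_val_of_base hD)

theorem IsLayered.eq_base_or_eq_var_of_reduces (h : IsLayered 𝕃 R)
    (hD : Reduces R (base 𝕃 m s) D) : D = base 𝕃 m (val D) ∨ D = .var (.inr (val D)) := by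
  induction hD with
  | refl => exact Or.inl (by rw [h.isLayerSystem.val_base])
  | tail _ hD ih =>
    rcases ih with ih | ih
    · exact h.eq_base_or_eq_var (ih ▸ hD)
    · exact (not_rewrites_var (ih ▸ hD)).elim

theorem IsLayered.baseReduces_of_reduces_base (h : IsLayered 𝕃 R)
    (hD : Reduces R (base 𝕃 m s) D) : BaseReduces 𝕃 R m s (val D) := by
  induction hD with
  | refl => rw [h.isLayerSystem.val_base]
  | @tail D' D hsD' hD ih =>
    rcases h.eq_base_or_eq_var_of_reduces hsD' with hD' | hD'
    · exact ih.tail ⟨D, hD' ▸ hD, rfl⟩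
    · exact (not_rewrites_var (hD' ▸ hD)).elim

theorem IsLayered.baseReduces_of_rankLE (h : IsLayered 𝕃 R) (hs : RankLE 𝕃 (m + 1) s)
    (hst : Reduces R s t) : BaseReduces 𝕃 R m s t := by
  have hred : Reduces R (unlabelled s) (unlabelled t) := hst.subst _
  rw [← h.isLayerSystem.base_eq_unlabelled hs] at hred
  simpa only [val_unlabelled] using h.baseReduces_of_reduces_base hred

theorem IsLayered.reduces_base_or_alien (h : IsLayered 𝕃 R) (hs : RankLE 𝕃 (k + 1) s)
    (hst : BaseReduces 𝕃 R m s t) :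
    Reduces R (base 𝕃 m s) (base 𝕃 m t) ∨ ∃ a, RankLE 𝕃 k a ∧
      Reduces R (base 𝕃 m s) (.var (.inr a)) ∧ Reduces R a t := by
  induction hst with
  | refl => exact Or.inl .refl
  | tail _ hst ih =>
    rcases ih with ih | ⟨a, ha, hsa, hau⟩
    · obtain ⟨D, hD, rfl⟩ := hst
      have hsD : Reduces R (base 𝕃 m s) D := ih.tail hD
      rcases h.eq_base_or_eq_var hD with hDbase | hDvar
      · exact Or.inl (hDbase ▸ hsD)
      · rw [hDvar] at hsD
        exact Or.inr ⟨_, rankLE_of_mem_vars_base hs (hsD.vars_subset (mem_vars_var.2 rfl)), hsD,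
          .refl⟩
    · exact Or.inr ⟨a, ha, hsa, hau.trans (h.isLayerSystem.reduces_of_baseReduces (.single hst))⟩

theorem eq_of_reduces_var {X : Type*} {x : X} {t : F.Term X} (h : Reduces R (.var x) t) :
    t = .var x := by
  induction h with
  | refl => rfl
  | tail _ h ih => exact (not_rewrites_var (ih ▸ h)).elim

theorem IsLayered.baseReduces_join [Infinite V] (h : IsLayered 𝕃 R)
    (hconf : ∀ t, RankLE 𝕃 (m + 1) t → ConfluentAt (Rewrites R) t) (hs : RankLE 𝕃 (m + 2) s)
    (h₁ : BaseReduces 𝕃 R m s t₁) (h₂ : BaseReduces 𝕃 R m s t₂) :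
    Relation.Join (BaseReduces 𝕃 R m) t₁ t₂ := by
  have hb := h.isLayerSystem.confluentAt_base h.condC2 hconf s
  rcases h.reduces_base_or_alien hs h₁ with d₁ | ⟨a, ha, d₁, e₁⟩ <;>
    rcases h.reduces_base_or_alien hs h₂ with d₂ | ⟨b, hb', d₂, e₂⟩ <;>
    obtain ⟨D, hD₁, hD₂⟩ := hb _ _ d₁ d₂
  · exact ⟨val D, h.baseReduces_of_reduces_base hD₁, h.baseReduces_of_reduces_base hD₂⟩
  · obtain rfl := eq_of_reduces_var hD₂
    exact ⟨t₂, (h.baseReduces_of_reduces_base hD₁).trans (h.baseReduces_of_rankLE hb' e₂), .refl⟩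
  · obtain rfl := eq_of_reduces_var hD₁
    exact ⟨t₁, .refl, (h.baseReduces_of_reduces_base hD₂).trans (h.baseReduces_of_rankLE ha e₁)⟩
  · obtain rfl := eq_of_reduces_var hD₁
    obtain rfl : a = b := by cases eq_of_reduces_var hD₂; rfl
    obtain ⟨u, hu₁, hu₂⟩ := hconf a ha _ _ e₁ e₂
    exact ⟨u, h.baseReduces_of_rankLE (h.rankLE_of_reduces ha e₁) hu₁,
      h.baseReduces_of_rankLE (h.rankLE_of_reduces ha e₂) hu₂⟩

end BaseSteps

section AlienReductions

variable {F : FirstOrder.Language.{u, v}} {V : Type w} {𝕃 : Set (Ctx F V)} {R : TRS F V}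
  {s t s' : F.Term V} {D E Z : LTerm F V} {ψ : F.Term V → F.Term V} {m : ℕ}

/-- Reduction of the tall aliens of a term such that equal aliens are reduced to equal terms. -/
def AlienReduces (𝕃 : Set (Ctx F V)) (R : TRS F V) (m : ℕ) (s t : F.Term V) : Prop :=
  ∃ ψ : F.Term V → F.Term V, (∀ a, .inr a ∈ vars (base 𝕃 m s) → Reduces R a (ψ a)) ∧
    t = (base 𝕃 m s).subst (Sum.elim .var ψ)

theorem IsLayerSystem.alienReduces_refl (h : IsLayerSystem 𝕃) (s : F.Term V) :
    AlienReduces 𝕃 R m s s :=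
  ⟨id, fun _ _ => .refl, (h.val_base s).symm⟩

theorem IsLayerSystem.reduces_of_alienReduces (h : IsLayerSystem 𝕃)
    (hst : AlienReduces 𝕃 R m s t) : Reduces R s t := by
  obtain ⟨ψ, hψ, rfl⟩ := hst
  conv => arg 2; rw [← h.val_base (m := m) s]
  refine (isCompatible_reduces R).subst ?_
  rintro (x | a) ha
  · exact .refl
  · exact hψ a ha

theorem AlienReduces.exists_relabels (h : AlienReduces 𝕃 R m s t) :
    ∃ E, Relabels (fun a b => Reduces R a b ∧ (RankLE 𝕃 m a → a = b)) (aliens 𝕃 s) E ∧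
      val E = t := by
  classical
  obtain ⟨ψ, hψ, rfl⟩ := h
  refine ⟨_, relabels_subst (φ := fun a => if RankLE 𝕃 m a then a else ψ a) fun a ha => ?_, ?_⟩
  · by_cases hrank : RankLE 𝕃 m a
    · simp only [if_pos hrank, implies_true, and_true]
      exact .refl
    · refine ⟨?_, fun h => (hrank h).elim⟩
      rw [if_neg hrank]
      exact hψ a (mem_vars_subst.2 ⟨_, ha, by simp [hrank]⟩)
  · rw [val, base, unfoldLabels, subst_subst, subst_subst]
    refine subst_congr ?_
    rintro (x | a) -
    · rfl
    by_cases hrank : RankLE 𝕃 m a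
    · simpa [hrank, unlabelled_subst] using (subst_var a).symm
    · simp [hrank]

theorem IsLayered.retagged_of_relabels (h : IsLayered 𝕃 R) (hs : RankLE 𝕃 (m + 2) s)
    (hE : Relabels (Reduces R) (aliens 𝕃 s) E) : Retagged (RankLE 𝕃 (m + 1)) (aliens 𝕃 s) E :=
  hE.imp fun a _ ha _ hab => Or.inr (h.rankLE_of_reduces (hs a ha) hab)

theorem Relabels.isFunPos_unfoldLabels (h : Relabels (fun a b => RankLE 𝕃 m a → a = b) D E) :
    ∀ p, IsFunPos (unfoldLabels 𝕃 m D) p → IsFunPos (unfoldLabels 𝕃 m E) p := by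
  refine RelSubst.subst h isCompatible_isFunPos ?_
  rintro (x | a) W hW p hp
  · obtain rfl := hW
    exact hp
  · obtain ⟨b, rfl, hab⟩ := hW
    by_cases ha : RankLE 𝕃 m a
    · exact hab ha ▸ hp
    · rw [Sum.elim_inr, if_neg ha] at hp
      exact (not_isFunPos_var _ p hp).elim

theorem Expanded.isFunPos_unfoldLabels (h : Expanded 𝕃 (RankLE 𝕃 (m + 1)) E Z) :
    ∀ p, IsFunPos (unfoldLabels 𝕃 m E) p → IsFunPos (unfoldLabels 𝕃 m Z) p := by
  refine RelSubst.subst h isCompatible_isFunPos ?_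
  rintro (x | b) W hW p hp
  · obtain rfl := hW
    exact hp
  rcases hW with rfl | ⟨hb, hval, hlt⟩
  · exact hp
  by_cases hbm : RankLE 𝕃 m b
  · rw [Sum.elim_inr, if_pos hbm] at hp
    change IsFunPos (unfoldLabels 𝕃 m W) p
    rwa [unfoldLabels_eq_unlabelled fun c hc => hlt c hc m hb, hval]
  · rw [Sum.elim_inr, if_neg hbm] at hp
    exact (not_isFunPos_var _ p hp).elim

theorem IsLayered.isFunPos_base_of_alienReduces (h : IsLayered 𝕃 R) (hs : RankLE 𝕃 (m + 2) s)
    (hst : AlienReduces 𝕃 R m s t) {p : List ℕ} (hp : IsFunPos (base 𝕃 m s) p) :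
    IsFunPos (base 𝕃 m t) p := by
  obtain ⟨E, hE, rfl⟩ := hst.exists_relabels
  have hretag := h.retagged_of_relabels hs (hE.imp fun _ _ _ _ hab => hab.1)
  refine (h.isLayerSystem.expanded_aliens h.condC2 hretag).isFunPos_unfoldLabels p ?_
  exact (hE.imp fun _ _ _ _ hab => hab.2).isFunPos_unfoldLabels p hp

theorem IsLayered.alienReduces_baseStep (h : IsLayered 𝕃 R) (hs : RankLE 𝕃 (m + 2) s)
    (hst : AlienReduces 𝕃 R m s t) (hss' : BaseStep 𝕃 R m s s') :
    ∃ t', BaseReduces 𝕃 R m t t' ∧ (AlienReduces 𝕃 R m s' t' ∨ BaseReduces 𝕃 R m s' t') := by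
  have hfun := fun p => h.isFunPos_base_of_alienReduces hs hst (p := p)
  obtain ⟨ψ, hψ, rfl⟩ := hst
  obtain ⟨D, hD, rfl⟩ := hss'
  have hDs := h.eq_base_or_eq_var hD
  obtain ⟨ρ, hρ, p, hD⟩ := hD
  refine ⟨D.subst (Sum.elim .var ψ), ?_, ?_⟩
  · obtain ⟨D', hD', hval, -⟩ := h.stepAt_base hρ (hD.subst _) (hfun p hD.isFunPos)
    exact .single ⟨D', ⟨ρ, hρ, p, hD'⟩, hval⟩
  · rcases hDs with hDs | hDs
    · refine Or.inl ⟨ψ, fun a ha => hψ a (hD.vars_subset (hDs ▸ ha)), ?_⟩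
      rw [← hDs]
    · have ha : .inr (val D) ∈ vars (base 𝕃 m s) := hD.vars_subset (hDs ▸ mem_vars_var.2 rfl)
      have hred := h.baseReduces_of_rankLE (rankLE_of_mem_vars_base hs ha) (hψ _ ha)
      rw [show D.subst (Sum.elim .var ψ) = ψ (val D) from congrArg (Term.subst · _) hDs]
      exact Or.inr hred

theorem IsLayered.alienReduces_baseReduces [Infinite V] (h : IsLayered 𝕃 R)
    (hconf : ∀ t, RankLE 𝕃 (m + 1) t → ConfluentAt (Rewrites R) t) (hs : RankLE 𝕃 (m + 2) s)
    (hst : AlienReduces 𝕃 R m s t) (hss' : BaseReduces 𝕃 R m s s') :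
    ∃ t', BaseReduces 𝕃 R m t t' ∧ (AlienReduces 𝕃 R m s' t' ∨ BaseReduces 𝕃 R m s' t') := by
  induction hss' with
  | refl => exact ⟨t, .refl, Or.inl hst⟩
  | @tail u s' hsu hus ih =>
    have hu := h.rankLE_of_reduces hs (h.isLayerSystem.reduces_of_baseReduces hsu)
    obtain ⟨t', htt', hut | hut⟩ := ih
    · obtain ⟨t'', ht', hs'⟩ := h.alienReduces_baseStep hu hut hus
      exact ⟨t'', htt'.trans ht', hs'⟩
    · obtain ⟨t'', ht', hs'⟩ := h.baseReduces_join hconf hu hut (.single hus)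
      exact ⟨t'', htt'.trans ht', Or.inr hs'⟩

/-- Labels that are short or have become partly visible are reduced in the base, the others later as
tall aliens. -/
theorem Expanded.exists_reduces (h : Expanded 𝕃 (RankLE 𝕃 (m + 1)) E Z)
    (hψ : ∀ a, .inr a ∈ vars E → Reduces R a (ψ a)) :
    ∃ D, RelLabels (fun b W => W = .var (.inr b) ∨ W = unlabelled (ψ b)) E D ∧
      Reduces R (unfoldLabels 𝕃 m Z) D := by
  refine RelSubst.exists_relSubst h (isCompatible_reduces R) ?_
  have hunlabelled {b} (hb : .inr b ∈ vars E) : Reduces R (unlabelled b) (unlabelled (ψ b)) :=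
    (hψ b hb).subst _
  rintro (x | b) hx W hW
  · obtain rfl := hW
    exact ⟨_, rfl, .refl⟩
  change ∃ W', _ ∧ Reduces R (unfoldLabels 𝕃 m W) W'
  rcases hW with rfl | ⟨hb, hval, hlt⟩
  · by_cases hb : RankLE 𝕃 m b
    · exact ⟨_, Or.inr rfl, unfoldLabels_inr_of_rankLE hb ▸ hunlabelled hx⟩
    · refine ⟨_, Or.inl rfl, ?_⟩
      rw [unfoldLabels_inr_of_not_rankLE hb]
  · rw [unfoldLabels_eq_unlabelled fun c hc => hlt c hc m hb, hval]
    exact ⟨_, Or.inr rfl, hunlabelled hx⟩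

end AlienReductions

section LayerReductions

variable {F : FirstOrder.Language.{u, v}} {V : Type w} {𝕃 : Set (Ctx F V)} {R : TRS F V}
  {s t u t₁ t₂ : F.Term V} {E E₁ E₂ : LTerm F V} {ψ : F.Term V → F.Term V} {m : ℕ}

/-- A reduction of the base of a term, followed by a reduction of the tall aliens of the result. -/
def LayerReduces (𝕃 : Set (Ctx F V)) (R : TRS F V) (m : ℕ) (s t : F.Term V) : Prop :=
  ∃ u, BaseReduces 𝕃 R m s u ∧ AlienReduces 𝕃 R m u t

theorem IsLayerSystem.layerReduces_of_baseReduces (h : IsLayerSystem 𝕃)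
    (hst : BaseReduces 𝕃 R m s t) : LayerReduces 𝕃 R m s t :=
  ⟨t, hst, h.alienReduces_refl t⟩

theorem AlienReduces.layerReduces (hst : AlienReduces 𝕃 R m s t) : LayerReduces 𝕃 R m s t :=
  ⟨s, .refl, hst⟩

theorem LayerReduces.base_trans (hst : BaseReduces 𝕃 R m s t) (htu : LayerReduces 𝕃 R m t u) :
    LayerReduces 𝕃 R m s u :=
  htu.imp fun _ h => ⟨hst.trans h.1, h.2⟩

theorem IsLayerSystem.reduces_of_layerReduces (h : IsLayerSystem 𝕃)
    (hst : LayerReduces 𝕃 R m s t) : Reduces R s t := by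
  obtain ⟨u, hsu, hut⟩ := hst
  exact (h.reduces_of_baseReduces hsu).trans (h.reduces_of_alienReduces hut)

theorem IsLayered.layerReduces_subst (h : IsLayered 𝕃 R)
    (hE : Retagged (RankLE 𝕃 (m + 1)) (aliens 𝕃 s) E)
    (hψ : ∀ a, .inr a ∈ vars E → Reduces R a (ψ a)) :
    LayerReduces 𝕃 R m (val E) (E.subst (Sum.elim .var ψ)) := by
  have hL := h.isLayerSystem
  obtain ⟨D, hED, hD⟩ := (hL.expanded_aliens h.condC2 hE).exists_reduces hψ
  have hvars {a} (ha : .inr a ∈ vars D) : .inr a ∈ vars E := by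
    obtain ⟨q, y, W, hy, -, hW, ha⟩ := RelSubst.exists_subtermAt_of_mem_vars hED ha
    rcases y with x | b
    · obtain rfl := hW
      simp at ha
    · rcases hW with rfl | rfl
      · exact vars_subset_of_subtermAt hy ha
      · exact (inr_notMem_vars_unlabelled ha).elim
  have hsubst : E.subst (Sum.elim .var ψ) = D.subst (Sum.elim .var ψ) := by
    refine RelSubst.subst hED isCompatible_eq ?_
    rintro (x | b) W hW
    · obtain rfl := hW
      rfl
    · rcases hW with rfl | rfl
      · rfl
      · exact ((unlabelled_subst _ _).trans (subst_var _)).symm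
  have hDbase : D = base 𝕃 m (val D) := (h.eq_base_or_eq_var_of_reduces hD).resolve_right <| by
    intro hDvar
    rw [hDvar] at hED
    cases E with
    | func f ts => cases hED
    | var y =>
      rcases y with x | b
      · cases relSubst_var_iff.1 hED
      · exact hL.maxTop_ne_hole s ((shape_aliens s).symm.trans hE.shape_eq)
  exact ⟨val D, h.baseReduces_of_reduces_base hD, ψ, fun a ha => hψ a (hvars (hDbase ▸ ha)),
    by rw [← hDbase, hsubst]⟩

theorem IsLayered.layerReduces_join (h : IsLayered 𝕃 R)
    (hconf : ∀ t, RankLE 𝕃 (m + 1) t → ConfluentAt (Rewrites R) t) (hs : RankLE 𝕃 (m + 2) s)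
    (h₁ : Retagged (RankLE 𝕃 (m + 1)) (aliens 𝕃 s) E₁)
    (h₂ : Retagged (RankLE 𝕃 (m + 1)) (aliens 𝕃 s) E₂)
    (hjoin : Relabels (Relation.Join (Reduces R)) E₁ E₂) :
    Relation.Join (LayerReduces 𝕃 R m) (val E₁) (val E₂) := by
  have hfinite : (Sum.inr ⁻¹' (vars E₁ ∪ vars E₂)).Finite :=
    ((finite_vars E₁).union (finite_vars E₂)).preimage Sum.inr_injective.injOn
  obtain ⟨ψ, hψ, hbalanced⟩ := exists_balanced_reducts (r := Rewrites R) hfinite <| by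
    rintro a (ha | ha)
    · exact hconf a (h₁.of_mem_vars hs ha)
    · exact hconf a (h₂.of_mem_vars hs ha)
  refine ⟨E₁.subst (Sum.elim .var ψ), h.layerReduces_subst h₁ fun a ha => hψ a (Or.inl ha), ?_⟩
  have hE : Relabels (fun a b => ψ a = ψ b) E₁ E₂ :=
    hjoin.imp fun a b ha hb => hbalanced a (Or.inl ha) b (Or.inr hb)
  rw [hE.subst_eq]
  exact h.layerReduces_subst h₂ fun a ha => hψ a (Or.inr ha)

theorem IsLayered.join_of_alienReduces (h : IsLayered 𝕃 R)
    (hconf : ∀ t, RankLE 𝕃 (m + 1) t → ConfluentAt (Rewrites R) t) (hs : RankLE 𝕃 (m + 2) s)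
    (h₁ : AlienReduces 𝕃 R m s t₁) (h₂ : AlienReduces 𝕃 R m s t₂) :
    Relation.Join (LayerReduces 𝕃 R m) t₁ t₂ := by
  obtain ⟨E₁, hE₁, rfl⟩ := h₁.exists_relabels
  obtain ⟨E₂, hE₂, rfl⟩ := h₂.exists_relabels
  have hE₁ := hE₁.imp fun _ _ _ _ hab => hab.1
  have hE₂ := hE₂.imp fun _ _ _ _ hab => hab.1
  refine h.layerReduces_join hconf hs (h.retagged_of_relabels hs hE₁)
    (h.retagged_of_relabels hs hE₂) ?_
  exact hE₁.comp hE₂ fun a b c ha hab hac => hconf a (hs a ha) b c hab hac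

theorem IsLayered.join_of_alienReduces_or_baseReduces [Infinite V] (h : IsLayered 𝕃 R)
    (hconf : ∀ t, RankLE 𝕃 (m + 1) t → ConfluentAt (Rewrites R) t) (hs : RankLE 𝕃 (m + 2) s)
    (h₁ : AlienReduces 𝕃 R m s t₁ ∨ BaseReduces 𝕃 R m s t₁)
    (h₂ : AlienReduces 𝕃 R m s t₂ ∨ BaseReduces 𝕃 R m s t₂) :
    Relation.Join (LayerReduces 𝕃 R m) t₁ t₂ := by
  have of_base {s t} : BaseReduces 𝕃 R m s t → LayerReduces 𝕃 R m s t :=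
    h.isLayerSystem.layerReduces_of_baseReduces
  rcases h₁ with h₁ | h₁ <;> rcases h₂ with h₂ | h₂
  · exact h.join_of_alienReduces hconf hs h₁ h₂
  · obtain ⟨v, htv, hv⟩ := h.alienReduces_baseReduces hconf hs h₁ h₂
    exact ⟨v, of_base htv, hv.elim AlienReduces.layerReduces of_base⟩
  · obtain ⟨v, htv, hv⟩ := h.alienReduces_baseReduces hconf hs h₂ h₁
    exact ⟨v, hv.elim AlienReduces.layerReduces of_base, of_base htv⟩
  · obtain ⟨v, htv, htv'⟩ := h.baseReduces_join hconf hs h₁ h₂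
    exact ⟨v, of_base htv, of_base htv'⟩

theorem IsLayered.layerReduces_diamond [Infinite V] (h : IsLayered 𝕃 R)
    (hconf : ∀ t, RankLE 𝕃 (m + 1) t → ConfluentAt (Rewrites R) t) (hs : RankLE 𝕃 (m + 2) s)
    (h₁ : LayerReduces 𝕃 R m s t₁) (h₂ : LayerReduces 𝕃 R m s t₂) :
    Relation.Join (LayerReduces 𝕃 R m) t₁ t₂ := by
  have hrank {a b} (ha : RankLE 𝕃 (m + 2) a) (hab : BaseReduces 𝕃 R m a b) :
      RankLE 𝕃 (m + 2) b :=
    h.rankLE_of_reduces ha (h.isLayerSystem.reduces_of_baseReduces hab)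
  obtain ⟨a, hsa, hat⟩ := h₁
  obtain ⟨b, hsb, hbt⟩ := h₂
  obtain ⟨c, hac, hbc⟩ := h.baseReduces_join hconf hs hsa hsb
  obtain ⟨d, htd, hcd⟩ := h.alienReduces_baseReduces hconf (hrank hs hsa) hat hac
  obtain ⟨e, hte, hce⟩ := h.alienReduces_baseReduces hconf (hrank hs hsb) hbt hbc
  obtain ⟨v, hdv, hev⟩ :=
    h.join_of_alienReduces_or_baseReduces hconf (hrank (hrank hs hsa) hac) hcd hce
  exact ⟨v, hdv.base_trans htd, hev.base_trans hte⟩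

theorem IsLayered.join_layerReduces_of_rewrites (h : IsLayered 𝕃 R)
    (hconf : ∀ t, RankLE 𝕃 (m + 1) t → ConfluentAt (Rewrites R) t) (hs : RankLE 𝕃 (m + 2) s)
    (hst : Rewrites R s t) : Relation.Join (LayerReduces 𝕃 R m) s t := by
  have hL := h.isLayerSystem
  obtain ⟨ρ, hρ, p, hst⟩ := hst
  rcases (hL.maxTop_fits s).isFunPos_or hst.isFunPos with hp | ⟨q, p, rfl, hq⟩
  · obtain ⟨D, hD, hval, -⟩ := h.stepAt_aliens hρ hst hp
    have hbase : BaseStep 𝕃 R m s t :=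
      ⟨unfoldLabels 𝕃 m D, ⟨ρ, hρ, p, hD.subst _⟩, (val_unfoldLabels D).trans hval⟩
    exact ⟨t, hL.layerReduces_of_baseReduces (.single hbase), hL.layerReduces_of_baseReduces .refl⟩
  · obtain ⟨a, b, ha, hab, rfl⟩ := hL.exists_stepAt_alien hst hq
    have hab : Rewrites R a b := ⟨ρ, hρ, p, hab⟩
    have haRank := hs a (vars_subset_of_subtermAt ha (mem_vars_var.2 rfl))
    have hbRank : RankLE 𝕃 (m + 1) b := h.rankLE_of_rewrites haRank hab
    have hjoin := h.layerReduces_join hconf hs (relabels_self fun _ _ => Or.inl rfl)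
      (retagged_replaceAt ha hbRank)
      (relabels_replaceAt (fun c => ⟨c, .refl, .refl⟩) ha ⟨b, .single hab, .refl⟩)
    rwa [hL.val_aliens] at hjoin

theorem IsLayered.confluentAt_succ [Infinite V] (h : IsLayered 𝕃 R)
    (hconf : ∀ t, RankLE 𝕃 (m + 1) t → ConfluentAt (Rewrites R) t) (hs : RankLE 𝕃 (m + 2) s) :
    ConfluentAt (Rewrites R) s :=
  confluentAt_of_diamond (S := {t | RankLE 𝕃 (m + 2) t}) (q := LayerReduces 𝕃 R m)
    (fun _ _ => h.rankLE_of_rewrites) (fun _ _ => h.isLayerSystem.reduces_of_layerReduces)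
    (fun _ ht _ _ => h.layerReduces_diamond hconf ht)
    (fun _ ht _ => h.join_layerReduces_of_rewrites hconf ht) hs

theorem IsLayered.confluentAt [Infinite V] (h : IsLayered 𝕃 R)
    (hrank : IsConfluentOn (Step R) {t : F.Term V | HasRank 𝕃 t 1}) (s : F.Term V) :
    ConfluentAt (Rewrites R) s := by
  suffices H : ∀ k t, RankLE 𝕃 (k + 1) t → ConfluentAt (Rewrites R) t by
    obtain ⟨k, hk⟩ := h.isLayerSystem.exists_rankLE s
    exact H k s hk.succ
  intro k
  induction k with
  | zero => exact fun t ht => hrank.confluentAt (h.isLayerSystem.hasRank_one ht)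
  | succ k ih => exact fun t => h.confluentAt_succ ih

end LayerReductions

end LayerSystem

theorem mainTheorem1_general (F : FirstOrder.Language.{u, v}) (V : Type w) [Infinite V]
    (𝕃 : Set (LayerSystem.Ctx F V)) (R : LayerSystem.TRS F V)
    (hlayered : LayerSystem.IsLayered 𝕃 R)
    (hrank : LayerSystem.IsConfluentOn (LayerSystem.Step R)
      {t : F.Term V | LayerSystem.HasRank 𝕃 t 1}) :
    LayerSystem.IsConfluent (LayerSystem.Step R) :=
  hlayered.confluentAt hrank

theorem mainTheorem1 (F : FirstOrder.Language.{u, v}) (V : Type w) [Countable V] [Infinite V]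
    (𝕃 : Set (LayerSystem.Ctx F V)) (R : LayerSystem.TRS F V)
    (hlayered : LayerSystem.IsLayered 𝕃 R)
    (hrank : LayerSystem.IsConfluentOn (LayerSystem.Step R)
      {t : F.Term V | LayerSystem.HasRank 𝕃 t 1}) :
    LayerSystem.IsConfluent (LayerSystem.Step R) :=
  mainTheorem1_general F V 𝕃 R hlayered hrank
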